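/- **Setting.** Fix a finite non-empty alphabet $\Sigma$. Let $X$ be a finite linearly ordered set of string variables, let $\mathcal A_x=(Q_x,\Delta_x,I_x,F_x)$ be an NFA over $\Sigma$ for each $x\in X$ (with pairwise disjoint state sets), let $u=u_1\cdots u_n$ and $v=v_1\cdots v_m$ ($n,m\ge 1$) be concatenations of variables of $X$, and let $\mathcal I$ be a finite conjunction of inequalities $t\le t'$ between linear integer terms over a set of integer variables. Let $\mathcal R$ be the conjunction of the constraints $x\in L(\mathcal A_x)$, $x\in X$, and let $|\mathcal R|=\sum_{x\in X}|Q_x|$. The predicate $\mathrm{contains}(u,v)$ holds under an assignment of words to the variables if the word $w_u$ obtained from $u$ is a factor of the word $w_v$ obtained from $v$. A run of an NFA is a (possibly empty) sequence of consecutive transitions starting in an initial state, and its Parikh image gives the number of occurrences of each transition. An NFA is *flat* if any two of its runs with the same Parikh image are equal. **The tag automaton.** Transitions of a tag automaton are labelled by finite sets of tags. Let $C$ have the states $\bigcup_x Q_x$, a transition $q\xrightarrow{\{S_a,L_x\}}r$ for each $(q,a,r)\in\Delta_x$, $x\in X$, and a transition $q\xrightarrow{\emptyset}r$ for $q\in F_x$,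 $r\in I_y$ whenever $y$ is the immediate successor of $x$ in $X$; its initial (final) states are the initial (final) states of the automaton of the least (greatest) variable. Let $T$ be the tag automaton with the states $(q,i)$, $q$ a state of $C$, $i\in\{1,2,3\}$, the initial states $(q,1)$ with $q$ initial in $C$, the final states $(q,1),(q,3)$ with $q$ final in $C$, the transitions $(q,i)\xrightarrow{\emptyset}(r,i)$, $i=1,2,3$, for each $q\xrightarrow{\emptyset}r$ of $C$, and, for each $q\xrightarrow{\{S_a,L_z\}}r$ of $C$, the transitions $$(q,1)\xrightarrow{\{S_a,P^1_z,L_z\}}(r,1),\quad (q,1)\xrightarrow{\{S_a,M^1_{a,z},P^2_z,L_z\}}(r,2),\quad (q,2)\xrightarrow{\{S_a,P^2_z,L_z\}}(r,2),$$ $$(q,2)\xrightarrow{\{S_a,M^2_{a,z},P^3_z,L_z\}}(r,3),\quad (q,3)\xrightarrow{\{S_a,P^3_z,L_z\}}(r,3).$$ **The formula.** For a set $\#$ of integer variables $\#\delta$ ($\delta$ a transition of $T$), $\#t$ ($t$ a tag) and $\gamma^I_q,\gamma^F_q,\sigma_q$ ($q$ a state of $T$), let $\mathrm{PF}(T,\#)$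 be the conjunction of: $0\le\gamma^I_q\le1$ for $q$ initial, $\gamma^I_q=0$ for other $q$, $\sum_{q\text{ initial}}\gamma^I_q=1$; $0\le\gamma^F_q\le 1$ for $q$ final, $\gamma^F_q=0$ for other $q$; for every state $q$ $$\gamma^I_q+\sum_{\delta\text{ into }q}\#\delta=\gamma^F_q+\sum_{\delta\text{ from }q}\#\delta,\qquad \sigma_q=0\leftrightarrow\gamma^I_q=1,$$ $$\sigma_q\le-1\to\Big(\gamma^I_q=0\wedge\bigwedge_{\delta\text{ into }q}\#\delta=0\Big),\qquad \sigma_q>0\to\bigvee_{\delta\text{ from }q'\text{ into }q}(\#\delta>0\wedge\sigma_{q'}\ge0\wedge\sigma_q=\sigma_{q'}+1);$$ $\#\delta\ge0$ for every $\delta$; and $\#t=\sum\{\#\delta: t \text{ is a tag of }\delta\}$ for every tag $t$. Further let - $\mathrm{Sym}(\#)$ be $\bigwedge_{a\in\Sigma}\sum_{x\in X}(\#M^1_{a,x}+\#M^2_{a,x})<2$; - $\mathrm{Mis}(\kappa,\#)$ be $\bigvee_{i\le n,\,j\le m}\big(\mathrm{Pos}_{i,j}\wedge\sum_a\#M^1_{a,x}>0\wedge\sum_a\#M^2_{a,y}>0\big)$,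 where $x=\min(u_i,v_j)$, $y=\max(u_i,v_j)$ and, with $\ell_u=\sum_{k<i}\#L_{u_k}$ and $\ell_v=\sum_{k<j}\#L_{v_k}$, $\mathrm{Pos}_{i,j}$ is $\kappa+\#P^1_{u_i}+\ell_u=\#P^2_{v_j}+\ell_v$ if $u_i<v_j$; it is $\kappa+\#P^2_{u_i}+\ell_u=\#P^1_{v_j}+\ell_v$ if $u_i>v_j$; and if $u_i=v_j=z$, it is $\kappa+\#P^1_z+\ell_u=\#P^1_z+\#P^2_z+\ell_v\ \vee\ \kappa+\#P^1_z+\#P^2_z+\ell_u=\#P^1_z+\ell_v$; - $\mathrm{Eq}(\#_1,\#_2)$ be the conjunction, over all transitions $q\xrightarrow{\{S_a,L_z\}}r$ of $C$, of $\sum_\delta\#_1\delta=\sum_\delta\#_2\delta$, where $\delta$ ranges over the transitions of $T$ from some $(q,i)$ to some $(r,j)$ whose tags include $S_a$; - $\mathrm{D}(\#)$ be the term $\sum_{j\le m}\#L_{v_j}-\sum_{i\le n}\#L_{u_i}$. Let $$\varphi^{\neg\mathrm{contains}}:\quad \mathrm{PF}(T,\#_1)\wedge\forall\kappa\,\exists\#_2\Big(\big(\mathrm{PF}(T,\#_2)\wedge\mathrm{Eq}(\#_1,\#_2)\wedge\mathrm{Sym}(\#_2)\wedge\mathrm{Mis}(\kappa,\#_2)\big)\vee\kappa<0\vee\kappa>\mathrm{D}(\#_1)\Big),$$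 a formula of linear integer arithmetic with the free variables $\#_1$ (all variables range over $\mathbb Z$). **Theorem.** Suppose that $\mathcal A_x$ is flat for every variable $x$ that occurs in $u$ or $v$. Then $\mathcal R\wedge\mathcal I\wedge\neg\mathrm{contains}(u,v)$ is satisfiable if and only if $\mathcal I\wedge\varphi^{\neg\mathrm{contains}}$ is satisfiable. Moreover, there is a polynomial $p$, depending only on $\Sigma$, such that the size of $\varphi^{\neg\mathrm{contains}}$ is at most $p(nm\cdot|\mathcal R|)$ whenever every $\mathcal A_x$ has at least one state. -/

import Mathlib

/-! ### Linear integer arithmetic (LIA): syntax, semantics, size -/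

/-- Linear integer terms over variables from `V`. -/
inductive LIATerm (V : Type*) where
  | var (x : V) : LIATerm V
  | const (k : ℤ) : LIATerm V
  | add (s t : LIATerm V) : LIATerm V
  | sub (s t : LIATerm V) : LIATerm V

namespace LIATerm

variable {V W : Type*}

def eval (α : V → ℤ) : LIATerm V → ℤ
  | var x => α x
  | const k => k
  | add s t => s.eval α + t.eval α
  | sub s t => s.eval α - t.eval α

/-- Number of symbols; an integer constant is counted with its binary length. -/
def size : LIATerm V → ℕ
  | var _ => 1
  | const k => 1 + Nat.size k.natAbs
  | add s t => s.size + t.size + 1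
  | sub s t => s.size + t.size + 1

def rename (f : V → W) : LIATerm V → LIATerm W
  | var x => var (f x)
  | const k => const k
  | add s t => add (s.rename f) (t.rename f)
  | sub s t => sub (s.rename f) (t.rename f)

def sum (l : List (LIATerm V)) : LIATerm V :=
  l.foldr add (const 0)

end LIATerm

/-- LIA formulae over variables from `V`; `all S φ` and `ex S φ` quantify over all the (finitely
many) variables in the block `S`. -/
inductive LIAFormula (V : Type*) where
  | le (s t : LIATerm V) : LIAFormula V
  | eq (s t : LIATerm V) : LIAFormula V
  | not (φ : LIAFormula V) : LIAFormula V
  | and (φ ψ : LIAFormula V) : LIAFormula V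
  | or (φ ψ : LIAFormula V) : LIAFormula V
  | all (S : Finset V) (φ : LIAFormula V) : LIAFormula V
  | ex (S : Finset V) (φ : LIAFormula V) : LIAFormula V

namespace LIAFormula

variable {V : Type*}

/-- `φ.holds α`: the integer assignment `α` is a model of `φ`. -/
def holds : LIAFormula V → (V → ℤ) → Prop
  | le s t, α => s.eval α ≤ t.eval α
  | eq s t, α => s.eval α = t.eval α
  | not φ, α => ¬ φ.holds α
  | and φ ψ, α => φ.holds α ∧ ψ.holds α
  | or φ ψ, α => φ.holds α ∨ ψ.holds α
  | all S φ, α => ∀ β : V → ℤ, (∀ x, x ∉ S → β x = α x) → φ.holds β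
  | ex S φ, α => ∃ β : V → ℤ, (∀ x, x ∉ S → β x = α x) ∧ φ.holds β

/-- Number of symbols, where a quantifier block counts all the variables it binds. -/
def size : LIAFormula V → ℕ
  | le s t => s.size + t.size + 1
  | eq s t => s.size + t.size + 1
  | not φ => φ.size + 1
  | and φ ψ => φ.size + ψ.size + 1
  | or φ ψ => φ.size + ψ.size + 1
  | all S φ => S.card + φ.size + 1
  | ex S φ => S.card + φ.size + 1

def Satisfiable (φ : LIAFormula V) : Prop :=
  ∃ α : V → ℤ, φ.holds α

def lt (s t : LIATerm V) : LIAFormula V :=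
  le (s.add (.const 1)) t

def imp (φ ψ : LIAFormula V) : LIAFormula V :=
  or (not φ) ψ

def iff (φ ψ : LIAFormula V) : LIAFormula V :=
  and (imp φ ψ) (imp ψ φ)

def conj (l : List (LIAFormula V)) : LIAFormula V :=
  l.foldr and (le (.const 0) (.const 0))

def disj (l : List (LIAFormula V)) : LIAFormula V :=
  l.foldr or (le (.const 1) (.const 0))

end LIAFormula

/-! ### Flat automata -/

namespace NFA

variable {A Q : Type*}

/-- `ρ` is a run of `M`: a sequence of consecutive transitions of `M`, the first of which leaves
an initial state. A transition from `q` to `r` reading `a` is the triple `(q, a, r)`. -/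
def IsRun (M : NFA A Q) (ρ : List (Q × A × Q)) : Prop :=
  (∀ t ∈ ρ, t.2.2 ∈ M.step t.1 t.2.1) ∧
  (∀ t ∈ ρ.head?, t.1 ∈ M.start) ∧
  ρ.IsChain (fun s t => s.2.2 = t.1)

open scoped Classical in
/-- Parikh image of a run: the number of occurrences of each transition. -/
noncomputable def parikh (ρ : List (Q × A × Q)) : Q × A × Q → ℕ :=
  fun t => ρ.countP fun s => s = t

/-- `M` is flat: every run is determined by its Parikh image. -/
def IsFlat (M : NFA A Q) : Prop :=
  ∀ ρ₁ ρ₂ : List (Q × A × Q), M.IsRun ρ₁ → M.IsRun ρ₂ → parikh ρ₁ = parikh ρ₂ → ρ₁ = ρ₂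

end NFA

/-! ### Tag automata and their Parikh formulae -/

/-- A tag automaton with set of states `S` and (finite) set of tags `tags`. -/
structure TagAutomaton (T S : Type*) where
  tags : Finset T
  trans : Finset (S × Finset T × S)
  init : Finset S
  final : Finset S

/-- The variables of the Parikh tag formula: the numbers of occurrences of transitions and of tags,
and for every state the indicators of being the first and the last state of the run, and the
distance from the first state in a spanning tree of the run (negative for unvisited states). -/
inductive ParikhVar (T S : Type*) where
  | trans (δ : S × Finset T × S) : ParikhVar T S
  | tag (t : T) : ParikhVar T S
  | init (q : S) : ParikhVar T S
  | final (q : S) : ParikhVar T S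
  | span (q : S) : ParikhVar T S

namespace TagAutomaton

open LIATerm LIAFormula

variable {T S V : Type*} [Fintype S] (B : TagAutomaton T S) (ν : ParikhVar T S → V)

open scoped Classical in
/-- All the variables that occur in the Parikh tag formula of `B`. -/
noncomputable def parikhVars : Finset (ParikhVar T S) :=
  B.trans.image .trans ∪ B.tags.image .tag ∪ Finset.univ.image .init ∪
    Finset.univ.image .final ∪ Finset.univ.image .span

/-! In the following formulae, `ν` is the naming of the Parikh variables. -/

open scoped Classical in
/-- The sum of the counts of all transitions of `B` that satisfy `P`. -/
noncomputable def transSum (P : S × Finset T × S → Prop) : LIATerm V :=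
  LIATerm.sum ((B.trans.filter P).toList.map fun δ => var (ν (.trans δ)))

open scoped Classical in
noncomputable def initFormula : LIAFormula V :=
  and (conj (B.init.toList.map fun q =>
        and (le (const 0) (var (ν (.init q)))) (le (var (ν (.init q))) (const 1))))
    (and (conj ((Finset.univ \ B.init).toList.map fun q => eq (var (ν (.init q))) (const 0)))
      (eq (LIATerm.sum (B.init.toList.map fun q => var (ν (.init q)))) (const 1)))

open scoped Classical in
noncomputable def finalFormula : LIAFormula V :=
  and (conj (B.final.toList.map fun q =>
        and (le (const 0) (var (ν (.final q)))) (le (var (ν (.final q))) (const 1))))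
    (conj ((Finset.univ \ B.final).toList.map fun q => eq (var (ν (.final q))) (const 0)))

/-- Kirchhoff's law for the state `q`. -/
noncomputable def kirchhoffFormula (q : S) : LIAFormula V :=
  eq (add (var (ν (.init q))) (B.transSum ν fun δ => δ.2.2 = q))
    (add (var (ν (.final q))) (B.transSum ν fun δ => δ.1 = q))

open scoped Classical in
/-- Consistency of the spanning tree at the state `q`. -/
noncomputable def spanFormula (q : S) : LIAFormula V :=
  and (iff (eq (var (ν (.span q))) (const 0)) (eq (var (ν (.init q))) (const 1)))
    (and
      (imp (le (var (ν (.span q))) (const (-1)))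
        (and (eq (var (ν (.init q))) (const 0))
          (conj ((B.trans.filter fun δ => δ.2.2 = q).toList.map fun δ =>
            eq (var (ν (.trans δ))) (const 0)))))
      (imp (lt (const 0) (var (ν (.span q))))
        (disj ((B.trans.filter fun δ => δ.2.2 = q).toList.map fun δ =>
          and (lt (const 0) (var (ν (.trans δ))))
            (and (le (const 0) (var (ν (.span δ.1))))
              (eq (var (ν (.span q))) (add (var (ν (.span δ.1))) (const 1))))))))

/-- The Parikh formula of `B`. The last conjunct says that the counts are natural numbers. -/
noncomputable def parikhFormula : LIAFormula V :=
  and (B.initFormula ν)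
    (and (B.finalFormula ν)
      (and (conj ((Finset.univ : Finset S).toList.map fun q =>
          and (B.kirchhoffFormula ν q) (B.spanFormula ν q)))
        (conj (B.trans.toList.map fun δ => le (const 0) (var (ν (.trans δ)))))))

/-- The Parikh tag formula of `B`. -/
noncomputable def parikhTagFormula : LIAFormula V :=
  and (B.parikhFormula ν)
    (conj (B.tags.toList.map fun t =>
      eq (var (ν (.tag t))) (B.transSum ν fun δ => t ∈ δ.2.1)))

end TagAutomaton

/-! ### The tag automaton of a single constraint with two mismatching positions -/

/-- Tags: read symbol, length, first and second mismatch, and positions. -/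
inductive Tag (A X : Type*) where
  | sym (a : A) : Tag A X
  | len (x : X) : Tag A X
  | mis₁ (a : A) (x : X) : Tag A X
  | mis₂ (a : A) (x : X) : Tag A X
  | pos₁ (x : X) : Tag A X
  | pos₂ (x : X) : Tag A X
  | pos₃ (x : X) : Tag A X

namespace NotContains

open LIATerm LIAFormula

variable {A X : Type*} [Fintype A] [Fintype X]

open scoped Classical in
/-- The tag automaton of an NFA `M` for the variable `x`, where every transition reading `a` is
tagged by the symbol `a` and the length tag of `x`. -/
noncomputable def lenTag {Q : Type*} [Fintype Q] (x : X) (M : NFA A Q) :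
    TagAutomaton (Tag A X) Q where
  tags := Finset.univ.image .sym ∪ {.len x}
  trans := ((Finset.univ : Finset (Q × A × Q)).filter fun t => t.2.2 ∈ M.step t.1 t.2.1).image
    fun t => (t.1, {.sym t.2.1, .len x}, t.2.2)
  init := Finset.univ.filter fun q => q ∈ M.start
  final := Finset.univ.filter fun q => q ∈ M.accept

variable [LinearOrder X]

open scoped Classical in
/-- The `ε`-concatenation of the tag automata `B x`, `x : X`, in the order of `X`: untagged
transitions lead from the final states of `B x` to the initial states of `B y` whenever `y` is the
immediate successor of `x`. -/
noncomputable def epsConcat {Q : X → Type*} [∀ x, Fintype (Q x)]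
    (B : ∀ x, TagAutomaton (Tag A X) (Q x)) : TagAutomaton (Tag A X) (Σ x, Q x) where
  tags := Finset.univ.biUnion fun x => (B x).tags
  trans :=
    (Finset.univ.biUnion fun x => (B x).trans.image fun t => (⟨x, t.1⟩, t.2.1, ⟨x, t.2.2⟩)) ∪
    ((Finset.univ : Finset ((Σ x, Q x) × (Σ x, Q x))).filter fun p =>
        p.1.1 ⋖ p.2.1 ∧ p.1.2 ∈ (B p.1.1).final ∧ p.2.2 ∈ (B p.2.1).init).image
      fun p => (p.1, ∅, p.2)
  init := Finset.univ.filter fun q => IsBot q.1 ∧ q.2 ∈ (B q.1).init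
  final := Finset.univ.filter fun q => IsTop q.1 ∧ q.2 ∈ (B q.1).final

open scoped Classical in
/-- The transitions of `C` that read the symbol `a` in the variable `z`. -/
noncomputable def letterTrans {S : Type*} (C : TagAutomaton (Tag A X) S) (a : A) (z : X) :
    Finset (S × Finset (Tag A X) × S) :=
  C.trans.filter fun t => t.2.1 = {.sym a, .len z}

open scoped Classical in
/-- Three copies of `C`, numbered `0, 1, 2` by the number of mismatches seen so far. -/
noncomputable def threeCopies {S : Type*} (C : TagAutomaton (Tag A X) S) :
    TagAutomaton (Tag A X) (S × Fin 3) where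
  tags := C.tags ∪
    (Finset.univ : Finset (A × X)).image (fun p => .mis₁ p.1 p.2) ∪
    (Finset.univ : Finset (A × X)).image (fun p => .mis₂ p.1 p.2) ∪
    Finset.univ.image .pos₁ ∪ Finset.univ.image .pos₂ ∪ Finset.univ.image .pos₃
  trans :=
    ((Finset.univ : Finset (A × X)).biUnion fun p => (letterTrans C p.1 p.2).biUnion fun t =>
      { ((t.1, 0), {.sym p.1, .pos₁ p.2, .len p.2}, (t.2.2, 0)),
        ((t.1, 0), {.sym p.1, .mis₁ p.1 p.2, .pos₂ p.2, .len p.2}, (t.2.2, 1)),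
        ((t.1, 1), {.sym p.1, .pos₂ p.2, .len p.2}, (t.2.2, 1)),
        ((t.1, 1), {.sym p.1, .mis₂ p.1 p.2, .pos₃ p.2, .len p.2}, (t.2.2, 2)),
        ((t.1, 2), {.sym p.1, .pos₃ p.2, .len p.2}, (t.2.2, 2)) }) ∪
    ((C.trans.filter fun t => t.2.1 = ∅).biUnion fun t =>
      Finset.univ.image fun i : Fin 3 => ((t.1, i), ∅, (t.2.2, i)))
  init := C.init ×ˢ {0}
  final := C.final ×ˢ {0, 2}

section Formula

variable {S V : Type*} [Fintype S]

/-- The count of the tag `t`, where `ν` is the naming of the Parikh variables. -/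
def tagCount {S' : Type*} (ν : ParikhVar (Tag A X) S' → V) (t : Tag A X) : LIATerm V :=
  var (ν (.tag t))

/-- The length of a concatenation of variables. -/
def lenSum {S' : Type*} (ν : ParikhVar (Tag A X) S' → V) (w : List X) : LIATerm V :=
  LIATerm.sum (w.map fun x => tagCount ν (.len x))

/-- The two mismatching symbols are different. -/
noncomputable def symFormula {S' : Type*} (ν : ParikhVar (Tag A X) S' → V) : LIAFormula V :=
  conj ((Finset.univ : Finset A).toList.map fun a =>
    lt (LIATerm.sum ((Finset.univ : Finset X).toList.map fun x =>
      add (tagCount ν (.mis₁ a x)) (tagCount ν (.mis₂ a x)))) (const 2))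

/-- The mismatch position in the occurrence `u[i]`, shifted by the offset `κ`, is the mismatch
position in the occurrence `v[j]`. -/
noncomputable def posFormula {S' : Type*} (κ : V) (ν : ParikhVar (Tag A X) S' → V)
    (u v : List X) (i : Fin u.length) (j : Fin v.length) : LIAFormula V :=
  let x := u.get i
  let y := v.get j
  let preU := lenSum ν (u.take i)
  let preV := lenSum ν (v.take j)
  if x = y then
    or
      (eq (add (var κ) (add (tagCount ν (.pos₁ x)) preU))
        (add (add (tagCount ν (.pos₁ x)) (tagCount ν (.pos₂ x))) preV))
      (eq (add (var κ) (add (add (tagCount ν (.pos₁ x)) (tagCount ν (.pos₂ x))) preU))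
        (add (tagCount ν (.pos₁ x)) preV))
  else if x < y then
    eq (add (var κ) (add (tagCount ν (.pos₁ x)) preU)) (add (tagCount ν (.pos₂ y)) preV)
  else
    eq (add (var κ) (add (tagCount ν (.pos₂ x)) preU)) (add (tagCount ν (.pos₁ y)) preV)

/-- There is a first mismatch in the variable `x` and a second mismatch in the variable `y`. -/
noncomputable def sampledFormula {S' : Type*} (ν : ParikhVar (Tag A X) S' → V) (x y : X) :
    LIAFormula V :=
  and
    (lt (const 0) (LIATerm.sum ((Finset.univ : Finset A).toList.map fun a =>
      tagCount ν (.mis₁ a x))))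
    (lt (const 0) (LIATerm.sum ((Finset.univ : Finset A).toList.map fun a =>
      tagCount ν (.mis₂ a y))))

/-- There are mismatch positions, one in an occurrence of a variable in `u` and one in an
occurrence of a variable in `v`, that are aligned when `u` is shifted by `κ`. -/
noncomputable def misFormula {S' : Type*} (κ : V) (ν : ParikhVar (Tag A X) S' → V)
    (u v : List X) : LIAFormula V :=
  disj ((List.finRange u.length).flatMap fun i => (List.finRange v.length).map fun j =>
    and (posFormula κ ν u v i j)
      (if u.get i ≤ v.get j then sampledFormula ν (u.get i) (v.get j)
        else sampledFormula ν (v.get j) (u.get i)))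

/-- The copies in `threeCopies C` of a transition `t` of `C` that reads `a` are taken equally often
in the two runs with Parikh variables `ν₁` and `ν₂`, for all `t` and `a`. -/
noncomputable def equalWordFormula (C : TagAutomaton (Tag A X) S)
    (ν₁ ν₂ : ParikhVar (Tag A X) (S × Fin 3) → V) : LIAFormula V :=
  conj ((Finset.univ : Finset (A × X)).toList.flatMap fun p =>
    (letterTrans C p.1 p.2).toList.map fun t =>
      let copies := fun r : (S × Fin 3) × Finset (Tag A X) × (S × Fin 3) =>
        r.1.1 = t.1 ∧ r.2.2.1 = t.2.2 ∧ .sym p.1 ∈ r.2.1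
      eq ((threeCopies C).transSum ν₁ copies) ((threeCopies C).transSum ν₂ copies))

/-- The length of `v` minus the length of `u`. -/
def lenDiff {S' : Type*} (ν : ParikhVar (Tag A X) S' → V) (u v : List X) : LIATerm V :=
  sub (lenSum ν v) (lenSum ν u)

end Formula

/-- Variables of the resulting formula: the integer variables `I` of the input, two disjoint sets
of Parikh variables, and the offset. -/
inductive Var (I T S : Type*) where
  | int (i : I) : Var I T S
  | fst (p : ParikhVar T S) : Var I T S
  | snd (p : ParikhVar T S) : Var I T S
  | offset : Var I T S

variable (I : Type*) {Q : X → Type*} [∀ x, Fintype (Q x)]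

open scoped Classical in
/-- The LIA formula for the constraint that the value of `v` does not contain the value of `u`,
where the values of each variable `x` are restricted to the language of `aut x`. -/
noncomputable def formula (aut : ∀ x, NFA A (Q x)) (u v : List X) :
    LIAFormula (Var I (Tag A X) ((Σ x, Q x) × Fin 3)) :=
  let C := epsConcat fun x => lenTag x (aut x)
  let B := threeCopies C
  and (B.parikhTagFormula .fst)
    (all {.offset} (ex (B.parikhVars.image .snd)
      (or
        (and (B.parikhTagFormula .snd)
          (and (equalWordFormula C .fst .snd)
            (and (symFormula .snd) (misFormula .offset .snd u v))))
        (or (lt (var .offset) (const 0))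
          (lt (lenDiff .fst u v) (var .offset))))))

variable {I}

/-- The conjunction of the integer constraints `c.1 ≤ c.2`, for `c` in `ints`. -/
def intFormula {T S : Type*} (ints : List (LIATerm I × LIATerm I)) : LIAFormula (Var I T S) :=
  conj (ints.map fun c => le (c.1.rename .int) (c.2.rename .int))

end NotContains

/-! ### The string constraint -/

/-- The value of a string term, i.e. of a concatenation of variables. -/
def termValue {A X : Type*} (σ : X → List A) (w : List X) : List A :=
  (w.map σ).flatten

/-- Satisfiability of the conjunction of the regular constraints `x ∈ L(aut x)` for all `x`, of the
integer constraints `c.1 ≤ c.2` for `c` in `ints`, and of `¬contains(u, v)`, where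
`contains(u, v)` says that the value of `u` is a factor of the value of `v`. -/
def NotContainsSatisfiable {A X I : Type*} {Q : X → Type*} (aut : ∀ x, NFA A (Q x))
    (ints : List (LIATerm I × LIATerm I)) (u v : List X) : Prop :=
  ∃ (σ : X → List A) (η : I → ℤ),
    (∀ x, σ x ∈ (aut x).accepts) ∧
    (∀ c ∈ ints, c.1.eval η ≤ c.2.eval η) ∧
    ¬ termValue σ u <:+: termValue σ v

/-!
By Kirchhoff's law, the counts in a Parikh model are those of the edges of an Eulerian path, once
the distances `span` make the edges reachable from the initial state; so the models of the Parikh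
tag formula are the tag counts of the accepting runs. An accepting run of `epsConcat` consists of
one run of each `aut x`, and an accepting run of `threeCopies` samples in addition either no
position or two positions in the values of variables, whose letters and offsets can be read off
the counts. Flatness makes the words determined by the transition counts, so `equalWordFormula`
forces the second run to read the words of the first one. Finally, `U` is not a factor of `V` if
and only if `U` placed at each offset `k ≤ |V| - |U|` has a position at which it differs from `V`;
the two sampled positions witness such a mismatch.
-/

/-! ### Paths in transition systems -/

open scoped Classical in
/-- The number of elements of `l` that satisfy `P`; classical, so that `P` needs no decidability
instance. -/
noncomputable def occ {E : Type*} (P : E → Prop) (l : List E) : ℕ :=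
  l.countP fun e => P e

section Occ

variable {E F : Type*} (P : E → Prop)

theorem occ_eq_countP [DecidablePred P] (l : List E) : occ P l = l.countP fun e => P e :=
  List.countP_congr (by simp)

@[simp] theorem occ_nil : occ P [] = 0 := rfl

theorem occ_cons [DecidablePred P] (e : E) (l : List E) :
    occ P (e :: l) = (if P e then 1 else 0) + occ P l := by
  simp [occ, List.countP_cons, add_comm]

theorem occ_append (l₁ l₂ : List E) : occ P (l₁ ++ l₂) = occ P l₁ + occ P l₂ :=
  List.countP_append

theorem occ_map (f : F → E) (l : List F) : occ P (l.map f) = occ (fun e => P (f e)) l := by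
  simp [occ, List.countP_map, Function.comp_def]

theorem occ_pos {l : List E} : 0 < occ P l ↔ ∃ e ∈ l, P e := by
  simp [occ, List.countP_pos_iff]

theorem occ_eq_zero {l : List E} : occ P l = 0 ↔ ∀ e ∈ l, ¬ P e := by
  simp [occ, List.countP_eq_zero]

@[simp] theorem occ_false (l : List E) : occ (fun _ => False) l = 0 :=
  (occ_eq_zero _).2 fun _ _ => id

theorem sum_occ_eq [DecidablePred P] (s : Finset E) (l : List E) (hl : ∀ e ∈ l, e ∈ s) :
    ∑ e ∈ s with P e, (occ (fun d => d = e) l : ℤ) = occ P l := by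
  classical
  induction l with
  | nil => simp
  | cons d l ih =>
    simp only [List.forall_mem_cons] at hl
    simp only [occ_cons, Nat.cast_add, Finset.sum_add_distrib, ih hl.2,
      Nat.cast_ite, Nat.cast_one, Nat.cast_zero, Finset.sum_ite_eq, Finset.mem_filter, hl.1,
      true_and]

end Occ

section Paths

variable {S L : Type*} {Δ : Set (S × L × S)} {p q r : S} {ρ : List (S × L × S)}

/-- `IsPath Δ p ρ r`: the transitions in `ρ` belong to `Δ` and lead, one after the other, from `p`
to `r`. A transition from `p` to `r` labelled by `l` is the triple `(p, l, r)`. -/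
def IsPath (Δ : Set (S × L × S)) : S → List (S × L × S) → S → Prop
  | p, [], r => p = r
  | p, t :: ρ, r => t ∈ Δ ∧ t.1 = p ∧ IsPath Δ t.2.2 ρ r

@[simp] theorem isPath_nil : IsPath Δ p [] r ↔ p = r := Iff.rfl

@[simp] theorem isPath_cons {t : S × L × S} :
    IsPath Δ p (t :: ρ) r ↔ t ∈ Δ ∧ t.1 = p ∧ IsPath Δ t.2.2 ρ r := Iff.rfl

theorem isPath_append {ρ' : List (S × L × S)} :
    IsPath Δ p (ρ ++ ρ') r ↔ ∃ q, IsPath Δ p ρ q ∧ IsPath Δ q ρ' r := by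
  induction ρ generalizing p with
  | nil => simp
  | cons t ρ ih => simp [ih, and_assoc]

theorem IsPath.mem (h : IsPath Δ p ρ r) {t : S × L × S} (ht : t ∈ ρ) : t ∈ Δ := by
  induction ρ generalizing p with
  | nil => simp at ht
  | cons s ρ ih =>
    rcases List.mem_cons.1 ht with rfl | ht
    exacts [h.1, ih h.2.2 ht]

theorem IsPath.of_forall_mem {Δ' : Set (S × L × S)} (h : IsPath Δ p ρ r)
    (hρ : ∀ t ∈ ρ, t ∈ Δ') : IsPath Δ' p ρ r := by
  induction ρ generalizing p with
  | nil => exact h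
  | cons t ρ ih =>
    rw [List.forall_mem_cons] at hρ
    exact ⟨hρ.1, h.2.1, ih h.2.2 hρ.2⟩

theorem IsPath.target_unique {r' : S} (h : IsPath Δ p ρ r) (h' : IsPath Δ p ρ r') : r = r' := by
  induction ρ generalizing p with
  | nil => exact h.symm.trans h'
  | cons t ρ ih => exact ih h.2.2 h'.2.2

theorem IsPath.exists_isPath_target (h : IsPath Δ p ρ r) {t : S × L × S} (ht : t ∈ ρ) :
    ∃ σ, IsPath {s | s ∈ ρ} p σ t.2.2 := by
  obtain ⟨ρ₁, ρ₂, rfl⟩ := List.append_of_mem ht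
  obtain ⟨_, h₁, htΔ, rfl, -⟩ := isPath_append.1 h
  have hpath : IsPath Δ p (ρ₁ ++ [t]) t.2.2 := isPath_append.2 ⟨_, h₁, htΔ, rfl, rfl⟩
  exact ⟨_, hpath.of_forall_mem fun s hs => by
    simp only [List.mem_append, List.mem_singleton] at hs
    simp only [Set.mem_ofPred_eq, List.mem_append, List.mem_cons]
    tauto⟩

theorem IsPath.isChain (h : IsPath Δ p ρ r) : ρ.IsChain fun s t => s.2.2 = t.1 := by
  induction ρ generalizing p with
  | nil => exact .nil
  | cons t ρ ih =>
    refine List.isChain_cons.2 ⟨?_, ih h.2.2⟩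
    cases ρ with
    | nil => simp
    | cons t' ρ => simpa using h.2.2.2.1.symm

theorem IsPath.map {S' L' : Type*} {Δ' : Set (S' × L' × S')} {f : S × L × S → S' × L' × S'}
    {g : S → S'} (hf : ∀ t ∈ Δ, f t ∈ Δ' ∧ (f t).1 = g t.1 ∧ (f t).2.2 = g t.2.2)
    (h : IsPath Δ p ρ r) : IsPath Δ' (g p) (ρ.map f) (g r) := by
  induction ρ generalizing p with
  | nil => exact congrArg g h
  | cons t ρ ih =>
    obtain ⟨hmem, hsrc, htgt⟩ := hf t h.1
    exact ⟨hmem, by rw [hsrc, h.2.1], by rw [htgt]; exact ih h.2.2⟩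

open scoped Classical in
/-- The in- and outdegrees in the multigraph `M` agree, except for what a path from `a` to `b`
allows. -/
def IsBalanced (M : Multiset (S × L × S)) (a b : S) : Prop :=
  ∀ q, M.countP (fun t => t.2.2 = q) + (if a = q then 1 else 0) =
    M.countP (fun t => t.1 = q) + (if b = q then 1 else 0)

open scoped Classical in
theorem IsPath.occ_target_add (h : IsPath Δ p ρ r) (q : S) :
    occ (fun t => t.2.2 = q) ρ + (if p = q then 1 else 0) =
      occ (fun t => t.1 = q) ρ + (if r = q then 1 else 0) := by
  induction ρ generalizing p with
  | nil => rw [isPath_nil.1 h]; rfl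
  | cons t ρ ih =>
    obtain ⟨-, rfl, h⟩ := h
    have := ih h
    simp only [occ_cons] at this ⊢
    omega

theorem IsPath.isBalanced (h : IsPath Δ p ρ r) : IsBalanced (ρ : Multiset (S × L × S)) p r :=
  h.occ_target_add

namespace IsBalanced

variable {M N : Multiset (S × L × S)} {a b c : S} {t : S × L × S}

open scoped Classical in
theorem sub (hM : IsBalanced M a b) (hN : IsBalanced N a c) (hle : N ≤ M) :
    IsBalanced (M - N) c b := by
  intro q
  have h₁ := hM q
  have h₂ := hN q
  rw [← Multiset.sub_add_cancel hle] at h₁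
  simp only [Multiset.countP_add] at h₁
  omega

open scoped Classical in
theorem sub_singleton (hM : IsBalanced M t.1 b) (ht : t ∈ M) :
    IsBalanced (M - {t}) t.2.2 b :=
  hM.sub (IsPath.isBalanced (Δ := Set.univ) (ρ := [t]) ⟨trivial, rfl, rfl⟩)
    (Multiset.singleton_le.2 ht)

open scoped Classical in
theorem coe_cons_le (ht : t ∈ M) (hρ : (ρ : Multiset (S × L × S)) ≤ M - {t}) :
    ((t :: ρ : List _) : Multiset (S × L × S)) ≤ M := by
  rw [← Multiset.cons_coe, ← Multiset.singleton_add]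
  exact (le_tsub_iff_left (Multiset.singleton_le.2 ht)).1 hρ

theorem exists_path (h : IsBalanced M a b) :
    ∃ ρ : List (S × L × S), (ρ : Multiset (S × L × S)) ≤ M ∧ IsPath Set.univ a ρ b := by
  classical
  induction hn : M.card generalizing M a with
  | zero =>
    obtain rfl := Multiset.card_eq_zero.1 hn
    have hab : a = b := by simpa using h b
    exact ⟨[], le_rfl, hab⟩
  | succ n ih =>
    by_cases hab : a = b
    · exact ⟨[], by simp, hab⟩
    have hpos : 0 < M.countP fun t => t.1 = a := by
      have := h a
      simp only [if_true, if_neg (Ne.symm hab)] at this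
      omega
    obtain ⟨t, ht, rfl⟩ := Multiset.countP_pos.1 hpos
    obtain ⟨ρ, hρ, hpath⟩ := ih (h.sub_singleton ht) (by
      rw [Multiset.card_sub (Multiset.singleton_le.2 ht), hn]; simp)
    exact ⟨t :: ρ, coe_cons_le ht hρ, trivial, rfl, hpath⟩

theorem exists_cycle (h : IsBalanced M b b) (ht : t ∈ M) :
    ∃ ρ : List (S × L × S), ((t :: ρ : List _) : Multiset (S × L × S)) ≤ M ∧
      IsPath Set.univ t.1 (t :: ρ) t.1 := by
  classical
  have hbal : IsBalanced M t.1 t.1 := fun q => by have := h q; omega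
  obtain ⟨ρ, hρ, hpath⟩ := (hbal.sub_singleton ht).exists_path
  exact ⟨ρ, coe_cons_le ht hρ, trivial, rfl, hpath⟩

/-- Follow a path of `M` that leads off `ρ`: it leaves `ρ` along a transition not used by `ρ`. -/
theorem exists_mem_sub_of_isPath [DecidableEq (S × L × S)] {ρ' : List (S × L × S)}
    (h : IsPath Set.univ a ρ b) (hq : IsPath {t | t ∈ M} q ρ' t.1) (ht : t ∈ M - ρ)
    (hp : ∃ ρ₁ ρ₂, ρ = ρ₁ ++ ρ₂ ∧ IsPath Set.univ a ρ₁ q) :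
    ∃ s ∈ M - ρ, ∃ ρ₁ ρ₂, ρ = ρ₁ ++ ρ₂ ∧ IsPath Set.univ a ρ₁ s.1 := by
  induction ρ' generalizing q with
  | nil => obtain rfl : q = t.1 := hq; exact ⟨t, ht, hp⟩
  | cons s ρ' ih =>
    obtain ⟨hsM, rfl, hq⟩ := hq
    by_cases hs : s ∈ ρ
    · obtain ⟨ρ₁, ρ₂, rfl⟩ := List.append_of_mem hs
      obtain ⟨_, h₁, -, rfl, -⟩ := isPath_append.1 h
      exact ih hq ⟨ρ₁ ++ [s], ρ₂, by simp, isPath_append.2 ⟨_, h₁, trivial, rfl, rfl⟩⟩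
    · refine ⟨s, ?_, hp⟩
      rw [Multiset.mem_sub, Multiset.coe_count, List.count_eq_zero_of_not_mem hs]
      exact Multiset.count_pos.2 hsM

theorem exists_longer_path (h : IsBalanced M a b)
    (hM : ∀ t ∈ M, ∃ ρ', IsPath {t | t ∈ M} a ρ' t.1) (hρ : (ρ : Multiset (S × L × S)) < M)
    (hpath : IsPath Set.univ a ρ b) :
    ∃ ρ' : List (S × L × S), (ρ' : Multiset (S × L × S)) ≤ M ∧ IsPath Set.univ a ρ' b ∧
      ρ.length < ρ'.length := by
  classical
  obtain ⟨t, ht⟩ := Multiset.exists_mem_of_ne_zero (tsub_pos_of_lt hρ).ne'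
  obtain ⟨ρ', hρ'⟩ := hM t (Multiset.mem_of_le tsub_le_self ht)
  obtain ⟨s, hs, ρ₁, ρ₂, rfl, h₁⟩ :=
    exists_mem_sub_of_isPath hpath hρ' ht ⟨[], ρ, rfl, rfl⟩
  obtain ⟨σ, hσ, hcycle⟩ := (h.sub hpath.isBalanced hρ.le).exists_cycle hs
  obtain ⟨p, h₁', h₂⟩ := isPath_append.1 hpath
  obtain rfl := h₁.target_unique h₁'
  refine ⟨ρ₁ ++ (s :: σ ++ ρ₂), ?_, isPath_append.2 ⟨_, h₁, isPath_append.2 ⟨_, hcycle, h₂⟩⟩, ?_⟩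
  · have := (le_tsub_iff_right hρ.le).1 hσ
    rwa [Multiset.coe_add, Multiset.coe_eq_coe.2 (List.perm_append_comm_assoc _ _ _)] at this
  · simp only [List.length_append, List.length_cons]
    omega

theorem exists_eulerian (h : IsBalanced M a b)
    (hM : ∀ t ∈ M, ∃ ρ', IsPath {t | t ∈ M} a ρ' t.1) :
    ∃ ρ : List (S × L × S), (ρ : Multiset (S × L × S)) = M ∧ IsPath Set.univ a ρ b := by
  by_contra! hcon
  have hlong (n : ℕ) : ∃ ρ : List (S × L × S), (ρ : Multiset (S × L × S)) ≤ M ∧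
      IsPath Set.univ a ρ b ∧ n ≤ ρ.length := by
    induction n with
    | zero => simpa using h.exists_path
    | succ n ih =>
      obtain ⟨ρ, hρ, hpath, hn⟩ := ih
      obtain ⟨ρ', hρ', hpath', hlt⟩ :=
        h.exists_longer_path hM (lt_of_le_of_ne hρ fun he => hcon ρ he hpath) hpath
      exact ⟨ρ', hρ', hpath', hn.trans_lt hlt⟩
  obtain ⟨ρ, hρ, -, hlen⟩ := hlong (M.card + 1)
  exact absurd (Multiset.card_le_card hρ) (by simpa using hlen)

end IsBalanced

open scoped Classical in
/-- The least number of transitions on a path in `Δ` from `p` to `q`, and `-1` if there is no such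
path, as the variables `ParikhVar.span` require. -/
noncomputable def pathDist (Δ : Set (S × L × S)) (p q : S) : ℤ :=
  if ∃ ρ, IsPath Δ p ρ q then (sInf {n | ∃ ρ, IsPath Δ p ρ q ∧ ρ.length = n} : ℕ) else -1

theorem IsPath.pathDist_le (h : IsPath Δ p ρ q) : pathDist Δ p q ≤ ρ.length := by
  rw [pathDist, if_pos ⟨ρ, h⟩]
  exact Int.ofNat_le.2 (Nat.sInf_le ⟨ρ, h, rfl⟩)

theorem pathDist_nonneg_iff : 0 ≤ pathDist Δ p q ↔ ∃ ρ, IsPath Δ p ρ q := by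
  rw [pathDist]
  split_ifs with h <;> simp [h]

theorem exists_isPath_length_eq_pathDist (h : 0 ≤ pathDist Δ p q) :
    ∃ ρ, IsPath Δ p ρ q ∧ (ρ.length : ℤ) = pathDist Δ p q := by
  obtain ⟨σ, hσ⟩ := pathDist_nonneg_iff.1 h
  have hne : {n | ∃ ρ, IsPath Δ p ρ q ∧ ρ.length = n}.Nonempty := ⟨σ.length, σ, hσ, rfl⟩
  obtain ⟨ρ, hρ, hlen⟩ := Nat.sInf_mem hne
  exact ⟨ρ, hρ, by rw [pathDist, if_pos ⟨σ, hσ⟩, hlen]⟩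

theorem pathDist_eq_zero_iff : pathDist Δ p q = 0 ↔ q = p := by
  constructor
  · intro h
    obtain ⟨ρ, hρ, hlen⟩ := exists_isPath_length_eq_pathDist h.ge
    obtain rfl : ρ = [] := by simpa [h] using hlen
    exact hρ.symm
  · rintro rfl
    have hnil : IsPath Δ q [] q := rfl
    exact le_antisymm hnil.pathDist_le (pathDist_nonneg_iff.2 ⟨_, hnil⟩)

theorem exists_pathDist_eq_add_one (h : 0 < pathDist Δ p q) :
    ∃ t ∈ Δ, t.2.2 = q ∧ 0 ≤ pathDist Δ p t.1 ∧ pathDist Δ p q = pathDist Δ p t.1 + 1 := by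
  obtain ⟨ρ, hρ, hlen⟩ := exists_isPath_length_eq_pathDist h.le
  obtain rfl | ⟨ρ, t, rfl⟩ := ρ.eq_nil_or_concat'
  · simp [← hlen] at h
  obtain ⟨_, hρ', htΔ, rfl, rfl⟩ := isPath_append.1 hρ
  have hnonneg := pathDist_nonneg_iff.2 ⟨ρ, hρ'⟩
  obtain ⟨σ, hσ, hσlen⟩ := exists_isPath_length_eq_pathDist hnonneg
  have hle := (isPath_append.2 ⟨_, hσ, htΔ, rfl, rfl⟩ : IsPath Δ p (σ ++ [t]) _).pathDist_le
  have hle' := hρ'.pathDist_le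
  simp only [List.length_append, List.length_singleton, Nat.cast_add, Nat.cast_one] at hlen hle
  exact ⟨t, htΔ, rfl, hnonneg, by omega⟩

end Paths

/-- A labelled transition system with initial and final states: the common form of the automata, the
tag automata and their concatenations below. -/
structure TransSystem (S L : Type*) where
  trans : Set (S × L × S)
  init : Set S
  final : Set S

/-- `ρ` is a run of `M` from an initial to a final state. -/
def TransSystem.IsAcceptingRun {S L : Type*} (M : TransSystem S L) (ρ : List (S × L × S)) : Prop :=
  ∃ p ∈ M.init, ∃ r ∈ M.final, IsPath M.trans p ρ r

/-! ### The Parikh tag formula -/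

namespace LIATerm

variable {V W : Type*}

theorem eval_sum (α : V → ℤ) (l : List (LIATerm V)) :
    (LIATerm.sum l).eval α = (l.map (eval α)).sum := by
  induction l with
  | nil => rfl
  | cons t l ih => rw [List.map_cons, List.sum_cons, ← ih]; rfl

theorem eval_sum_toList {ι : Type*} (α : V → ℤ) (s : Finset ι) (f : ι → LIATerm V) :
    (LIATerm.sum (s.toList.map f)).eval α = ∑ i ∈ s, (f i).eval α := by
  rw [eval_sum, List.map_map, Finset.sum_map_toList]
  rfl

theorem eval_rename (f : V → W) (α : W → ℤ) (t : LIATerm V) :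
    (t.rename f).eval α = t.eval (α ∘ f) := by
  induction t with
  | var x => rfl
  | const k => rfl
  | add s t hs ht => simp only [rename, eval, hs, ht]
  | sub s t hs ht => simp only [rename, eval, hs, ht]

end LIATerm

namespace LIAFormula

variable {V : Type*} {α : V → ℤ}

theorem holds_conj {l : List (LIAFormula V)} : (conj l).holds α ↔ ∀ φ ∈ l, φ.holds α := by
  induction l with
  | nil => simp [conj, holds]
  | cons φ l ih => rw [List.forall_mem_cons, ← ih]; rfl

theorem holds_disj {l : List (LIAFormula V)} : (disj l).holds α ↔ ∃ φ ∈ l, φ.holds α := by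
  induction l with
  | nil => simp [disj, holds, LIATerm.eval]
  | cons φ l ih => rw [List.exists_mem_cons_iff, ← ih]; rfl

theorem holds_conj_toList {ι : Type*} {s : Finset ι} {f : ι → LIAFormula V} :
    (conj (s.toList.map f)).holds α ↔ ∀ i ∈ s, (f i).holds α := by
  simp [holds_conj]

theorem holds_disj_toList {ι : Type*} {s : Finset ι} {f : ι → LIAFormula V} :
    (disj (s.toList.map f)).holds α ↔ ∃ i ∈ s, (f i).holds α := by
  simp [holds_disj]

theorem holds_lt {s t : LIATerm V} : (lt s t).holds α ↔ s.eval α < t.eval α :=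
  Iff.rfl

theorem holds_imp {φ ψ : LIAFormula V} : (imp φ ψ).holds α ↔ (φ.holds α → ψ.holds α) := by
  simp only [imp, holds]
  tauto

theorem holds_iff {φ ψ : LIAFormula V} : (iff φ ψ).holds α ↔ (φ.holds α ↔ ψ.holds α) := by
  simp only [iff, holds, holds_imp]
  tauto

end LIAFormula

open scoped Classical in
theorem exists_eq_indicator_of_sum_eq_one {ι : Type*} {s : Finset ι} {f : ι → ℤ}
    (hf : ∀ i ∈ s, 0 ≤ f i) (hf₀ : ∀ i ∉ s, f i = 0) (hsum : ∑ i ∈ s, f i = 1) :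
    ∃ j ∈ s, ∀ i, f i = if j = i then 1 else 0 := by
  obtain ⟨j, hj, hfj⟩ : ∃ j ∈ s, f j ≠ 0 := by
    by_contra! hcon
    exact zero_ne_one ((Finset.sum_eq_zero hcon).symm.trans hsum)
  have hrest : 0 ≤ ∑ i ∈ s.erase j, f i :=
    Finset.sum_nonneg fun i hi => hf i (Finset.mem_of_mem_erase hi)
  have hfj' := hf j hj
  rw [← Finset.add_sum_erase _ _ hj] at hsum
  refine ⟨j, hj, fun i => ?_⟩
  split_ifs with hij
  · subst hij; omega
  by_cases hi : i ∈ s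
  · have hzero : ∑ i ∈ s.erase j, f i = 0 := by omega
    exact (Finset.sum_eq_zero_iff_of_nonneg fun i hi => hf i (Finset.mem_of_mem_erase hi)).1
      hzero i (Finset.mem_erase.2 ⟨Ne.symm hij, hi⟩)
  · exact hf₀ i hi

namespace TagAutomaton

open LIATerm LIAFormula

variable {T S V : Type*} {B : TagAutomaton T S} {f : ParikhVar T S → ℤ}
  {ν : ParikhVar T S → V} {α : V → ℤ} {p r : S} {ρ : List (S × Finset T × S)}

/-- The transition system underlying a tag automaton. -/
def toTransSystem (B : TagAutomaton T S) : TransSystem S (Finset T) where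
  trans := B.trans
  init := B.init
  final := B.final

/-- The values `f` of the Parikh variables count the transitions and the tags of `ρ`. -/
structure CountsRun (B : TagAutomaton T S) (f : ParikhVar T S → ℤ)
    (ρ : List (S × Finset T × S)) : Prop where
  trans : ∀ δ ∈ B.trans, f (.trans δ) = occ (fun δ' => δ' = δ) ρ
  tag : ∀ t ∈ B.tags, f (.tag t) = occ (fun δ => t ∈ δ.2.1) ρ

open scoped Classical in
/-- The values `f` of the Parikh variables satisfy the Parikh tag formula of `B`; the fields are
its conjuncts. -/
structure IsParikhModel (B : TagAutomaton T S) (f : ParikhVar T S → ℤ) : Prop where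
  init_mem : ∀ q ∈ B.init, 0 ≤ f (.init q) ∧ f (.init q) ≤ 1
  init_notMem : ∀ q ∉ B.init, f (.init q) = 0
  sum_init : ∑ q ∈ B.init, f (.init q) = 1
  final_mem : ∀ q ∈ B.final, 0 ≤ f (.final q) ∧ f (.final q) ≤ 1
  final_notMem : ∀ q ∉ B.final, f (.final q) = 0
  kirchhoff : ∀ q, f (.init q) + ∑ δ ∈ B.trans with δ.2.2 = q, f (.trans δ) =
    f (.final q) + ∑ δ ∈ B.trans with δ.1 = q, f (.trans δ)
  span_eq_zero_iff : ∀ q, f (.span q) = 0 ↔ f (.init q) = 1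
  unvisited : ∀ q, f (.span q) ≤ -1 →
    f (.init q) = 0 ∧ ∀ δ ∈ B.trans, δ.2.2 = q → f (.trans δ) = 0
  exists_parent : ∀ q, 0 < f (.span q) → ∃ δ ∈ B.trans, δ.2.2 = q ∧
    0 < f (.trans δ) ∧ 0 ≤ f (.span δ.1) ∧ f (.span q) = f (.span δ.1) + 1
  trans_nonneg : ∀ δ ∈ B.trans, 0 ≤ f (.trans δ)
  tag_eq : ∀ t ∈ B.tags, f (.tag t) = ∑ δ ∈ B.trans with t ∈ δ.2.1, f (.trans δ)

theorem eval_transSum (P : S × Finset T × S → Prop) [DecidablePred P] :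
    (B.transSum ν P).eval α = ∑ δ ∈ B.trans with P δ, α (ν (.trans δ)) := by
  rw [transSum, eval_sum_toList]
  exact Finset.sum_congr (by congr!) fun _ _ => rfl

theorem CountsRun.sum_trans (h : B.CountsRun f ρ) (hρ : ∀ δ ∈ ρ, δ ∈ B.trans)
    (P : S × Finset T × S → Prop) [DecidablePred P] :
    ∑ δ ∈ B.trans with P δ, f (.trans δ) = occ P ρ := by
  rw [← sum_occ_eq P B.trans ρ hρ]
  exact Finset.sum_congr rfl fun δ hδ => h.trans δ (Finset.mem_filter.1 hδ).1

theorem CountsRun.eval_transSum (h : B.CountsRun (α ∘ ν) ρ) (hρ : ∀ δ ∈ ρ, δ ∈ B.trans)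
    (P : S × Finset T × S → Prop) : (B.transSum ν P).eval α = occ P ρ := by
  classical
  rw [TagAutomaton.eval_transSum, ← h.sum_trans hρ]
  rfl

theorem holds_parikhTagFormula [Fintype S] :
    (B.parikhTagFormula ν).holds α ↔ B.IsParikhModel (α ∘ ν) := by
  classical
  simp only [parikhTagFormula, parikhFormula, initFormula, finalFormula, kirchhoffFormula,
    spanFormula, holds, holds_conj_toList, holds_disj_toList, holds_iff, holds_imp, holds_lt, eval,
    eval_sum_toList, eval_transSum, Finset.mem_sdiff, Finset.mem_univ, Finset.mem_filter, true_and,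
    true_imp_iff, and_imp, and_assoc]
  constructor
  · rintro ⟨h₁, h₂, h₃, h₄, h₅, h₆, h₇, h₈⟩
    exact ⟨h₁, h₂, h₃, h₄, h₅, fun q => (h₆ q).1, fun q => (h₆ q).2.1,
      fun q => (h₆ q).2.2.1, fun q => (h₆ q).2.2.2, h₇, h₈⟩
  · intro h
    exact ⟨h.init_mem, h.init_notMem, h.sum_init, h.final_mem, h.final_notMem,
      fun q => ⟨h.kirchhoff q, h.span_eq_zero_iff q, h.unvisited q, h.exists_parent q⟩,
      h.trans_nonneg, h.tag_eq⟩

open scoped Classical in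
theorem IsParikhModel.exists_init (h : B.IsParikhModel f) :
    ∃ p ∈ B.init, ∀ q, f (.init q) = if p = q then 1 else 0 :=
  exists_eq_indicator_of_sum_eq_one (fun q hq => (h.init_mem q hq).1) h.init_notMem h.sum_init

/-- Summing Kirchhoff's law over the states cancels the transitions. -/
theorem IsParikhModel.sum_final (h : B.IsParikhModel f) :
    ∑ q ∈ B.final, f (.final q) = 1 := by
  classical
  let states := B.init ∪ B.final ∪ B.trans.image (·.1) ∪ B.trans.image (·.2.2)
  have hsum := Finset.sum_congr rfl (s₁ := states) fun q _ => h.kirchhoff q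
  have hfiber (g : S × Finset T × S → S) (hg : ∀ δ ∈ B.trans, g δ ∈ states) :
      ∑ q ∈ states, ∑ δ ∈ B.trans with g δ = q, f (.trans δ) = ∑ δ ∈ B.trans, f (.trans δ) :=
    Finset.sum_fiberwise_of_maps_to hg _
  have hinit : ∑ q ∈ states, f (.init q) = ∑ q ∈ B.init, f (.init q) :=
    (Finset.sum_subset (by grind) fun q _ => h.init_notMem q).symm
  have hfinal : ∑ q ∈ states, f (.final q) = ∑ q ∈ B.final, f (.final q) :=
    (Finset.sum_subset (by grind) fun q _ => h.final_notMem q).symm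
  rw [Finset.sum_add_distrib, Finset.sum_add_distrib, hfiber (·.2.2) (by grind),
    hfiber (·.1) (by grind), add_left_inj] at hsum
  rw [← hfinal, ← hsum, hinit, h.sum_init]

open scoped Classical in
theorem IsParikhModel.exists_final (h : B.IsParikhModel f) :
    ∃ r ∈ B.final, ∀ q, f (.final q) = if r = q then 1 else 0 :=
  exists_eq_indicator_of_sum_eq_one (fun q hq => (h.final_mem q hq).1) h.final_notMem h.sum_final

/-- The multigraph in which each transition of `B` has the multiplicity given by the values `f` of
the Parikh variables; its Eulerian paths are the runs that `f` counts. -/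
noncomputable def transMultiset (B : TagAutomaton T S) (f : ParikhVar T S → ℤ) :
    Multiset (S × Finset T × S) :=
  ∑ δ ∈ B.trans, Multiset.replicate (f (.trans δ)).toNat δ

theorem mem_transMultiset {δ : S × Finset T × S} :
    δ ∈ B.transMultiset f ↔ δ ∈ B.trans ∧ 0 < f (.trans δ) := by
  simp only [transMultiset, Multiset.mem_sum, Multiset.mem_replicate]
  constructor
  · rintro ⟨δ', hδ', hne, rfl⟩
    exact ⟨hδ', by omega⟩
  · rintro ⟨hδ, hpos⟩
    exact ⟨δ, hδ, by omega, rfl⟩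

namespace IsParikhModel

theorem countP_transMultiset (h : B.IsParikhModel f) (P : S × Finset T × S → Prop)
    [DecidablePred P] :
    ((B.transMultiset f).countP P : ℤ) = ∑ δ ∈ B.trans with P δ, f (.trans δ) := by
  rw [transMultiset, ← Multiset.coe_countPAddMonoidHom, map_sum, Nat.cast_sum, Finset.sum_filter]
  refine Finset.sum_congr rfl fun δ hδ => ?_
  rw [Multiset.coe_countPAddMonoidHom, ← Multiset.coe_replicate, Multiset.coe_countP,
    List.countP_replicate]
  by_cases hP : P δ <;> simp [hP, h.trans_nonneg δ hδ]

theorem countsRun (h : B.IsParikhModel f) (hρ : (ρ : Multiset _) = B.transMultiset f) :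
    B.CountsRun f ρ := by
  classical
  have hocc (P : S × Finset T × S → Prop) [DecidablePred P] :
      (occ P ρ : ℤ) = ∑ δ ∈ B.trans with P δ, f (.trans δ) := by
    rw [← h.countP_transMultiset, ← hρ, Multiset.coe_countP, occ_eq_countP]
  refine ⟨fun δ hδ => ?_, fun t ht => ?_⟩
  · rw [hocc, Finset.sum_filter, Finset.sum_ite_eq', if_pos hδ]
  · rw [hocc, h.tag_eq t ht]

open scoped Classical in
theorem isBalanced (h : B.IsParikhModel f) (hp : ∀ q, f (.init q) = if p = q then 1 else 0)
    (hr : ∀ q, f (.final q) = if r = q then 1 else 0) :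
    IsBalanced (B.transMultiset f) p r := by
  intro q
  have := h.kirchhoff q
  rw [← h.countP_transMultiset, ← h.countP_transMultiset, hp, hr] at this
  zify
  linarith

open scoped Classical in
/-- The variables `span` decrease along a path back to the initial state. -/
theorem exists_isPath (h : B.IsParikhModel f)
    (hp : ∀ q, f (.init q) = if p = q then 1 else 0) {q : S}
    (hq : 0 ≤ f (.span q)) : ∃ ρ, IsPath {δ | δ ∈ B.transMultiset f} p ρ q := by
  obtain ⟨n, hn⟩ := Int.eq_ofNat_of_zero_le hq
  induction n generalizing q with
  | zero =>
    have hinit := (h.span_eq_zero_iff q).1 hn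
    exact ⟨[], by simpa [hp] using hinit⟩
  | succ n ih =>
    obtain ⟨δ, hδ, rfl, hpos, hspan, hsucc⟩ := h.exists_parent q (by omega)
    obtain ⟨ρ, hρ⟩ := ih hspan (by omega)
    exact ⟨ρ ++ [δ], isPath_append.2 ⟨_, hρ, mem_transMultiset.2 ⟨hδ, hpos⟩, rfl, rfl⟩⟩

theorem span_nonneg (h : B.IsParikhModel f) {δ : S × Finset T × S}
    (hr : ∀ q, 0 ≤ f (.final q)) (hδ : δ ∈ B.transMultiset f) : 0 ≤ f (.span δ.1) := by
  classical
  obtain ⟨hδ, hpos⟩ := mem_transMultiset.1 hδ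
  by_contra! hneg
  obtain ⟨hinit, hinto⟩ := h.unvisited δ.1 (by omega)
  have hkirchhoff := h.kirchhoff δ.1
  rw [hinit, Finset.sum_eq_zero (fun e he => hinto e (Finset.mem_filter.1 he).1
    (Finset.mem_filter.1 he).2)] at hkirchhoff
  have hle : f (.trans δ) ≤ ∑ e ∈ B.trans with e.1 = δ.1, f (.trans e) :=
    Finset.single_le_sum (f := fun e => f (.trans e))
      (fun e he => h.trans_nonneg e (Finset.mem_filter.1 he).1) (Finset.mem_filter.2 ⟨hδ, rfl⟩)
  have := hr δ.1
  omega

theorem exists_isAcceptingRun (h : B.IsParikhModel f) :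
    ∃ ρ, B.toTransSystem.IsAcceptingRun ρ ∧ B.CountsRun f ρ := by
  obtain ⟨p, hp, hinit⟩ := h.exists_init
  obtain ⟨r, hr, hfinal⟩ := h.exists_final
  have hfinal_nonneg (q : S) : 0 ≤ f (.final q) := by rw [hfinal]; split_ifs <;> simp
  obtain ⟨ρ, hρ, hpath⟩ := (h.isBalanced hinit hfinal).exists_eulerian fun δ hδ =>
    h.exists_isPath hinit (h.span_nonneg hfinal_nonneg hδ)
  refine ⟨ρ, ⟨p, hp, r, hr, hpath.of_forall_mem fun δ hδ => ?_⟩, h.countsRun hρ⟩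
  exact (mem_transMultiset.1 (hρ ▸ Multiset.mem_coe.2 hδ)).1

end IsParikhModel

open scoped Classical in
/-- The values of the Parikh variables for the path `ρ` from `p` to `r`; the variables `span` take
the distances from `p` within `ρ`. -/
noncomputable def runValues (p : S) (ρ : List (S × Finset T × S)) (r : S) : ParikhVar T S → ℤ
  | .trans δ => occ (fun δ' => δ' = δ) ρ
  | .tag t => occ (fun δ => t ∈ δ.2.1) ρ
  | .init q => if p = q then 1 else 0
  | .final q => if r = q then 1 else 0
  | .span q => pathDist {δ | δ ∈ ρ} p q

theorem countsRun_runValues : B.CountsRun (runValues p ρ r) ρ :=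
  ⟨fun _ _ => rfl, fun _ _ => rfl⟩

theorem isParikhModel_runValues (hp : p ∈ B.init) (hr : r ∈ B.final)
    (h : IsPath (B.trans : Set (S × Finset T × S)) p ρ r) :
    B.IsParikhModel (runValues p ρ r) := by
  classical
  have hρ : ∀ δ ∈ ρ, δ ∈ B.trans := fun δ hδ => h.mem hδ
  have hsum := (countsRun_runValues (B := B) (p := p) (r := r)).sum_trans hρ
  have hspan (q : S) : pathDist {δ | δ ∈ ρ} p q = 0 ↔ p = q := pathDist_eq_zero_iff.trans eq_comm
  constructor
  case init_mem | final_mem => intro q _; simp only [runValues]; split_ifs <;> simp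
  case init_notMem => exact fun q hq => if_neg (ne_of_mem_of_not_mem hp hq)
  case final_notMem => exact fun q hq => if_neg (ne_of_mem_of_not_mem hr hq)
  case sum_init => exact (Finset.sum_ite_eq ..).trans (if_pos hp)
  case trans_nonneg => exact fun δ _ => Int.natCast_nonneg _
  case tag_eq => exact fun t _ => (hsum _).symm
  case span_eq_zero_iff => intro q; simp [runValues, hspan]
  case kirchhoff =>
    intro q
    rw [hsum, hsum]
    have := h.occ_target_add q
    simp only [runValues]
    zify at this
    linarith
  case unvisited =>
    intro q hq
    simp only [runValues] at hq
    refine ⟨if_neg fun hpq => ?_, ?_⟩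
    · rw [(hspan q).2 hpq] at hq
      omega
    · rintro δ - rfl
      refine Nat.cast_eq_zero.2 ((occ_eq_zero _).2 ?_)
      rintro δ hδ rfl
      have := pathDist_nonneg_iff.2 (h.exists_isPath_target hδ)
      omega
  case exists_parent =>
    intro q hq
    obtain ⟨δ, hδ, rfl, hnonneg, hdist⟩ := exists_pathDist_eq_add_one hq
    exact ⟨δ, hρ δ hδ, rfl, Nat.cast_pos.2 ((occ_pos _).2 ⟨δ, hδ, rfl⟩), hnonneg, hdist⟩

theorem exists_isParikhModel (h : B.toTransSystem.IsAcceptingRun ρ) :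
    ∃ f, B.IsParikhModel f ∧ B.CountsRun f ρ := by
  obtain ⟨p, hp, r, hr, h⟩ := h
  exact ⟨runValues p ρ r, isParikhModel_runValues hp hr h, countsRun_runValues⟩

theorem CountsRun.congr [Fintype S] (h : B.CountsRun f ρ)
    (hfg : ∀ z ∈ B.parikhVars, g z = f z) : B.CountsRun g ρ := by
  classical
  constructor
  · exact fun δ hδ => (hfg _ (by simp [parikhVars, hδ])).trans (h.trans δ hδ)
  · exact fun t ht => (hfg _ (by simp [parikhVars, ht])).trans (h.tag t ht)

theorem IsParikhModel.congr [Fintype S] (h : B.IsParikhModel f)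
    (hfg : ∀ z ∈ B.parikhVars, g z = f z) : B.IsParikhModel g := by
  classical
  have htrans : ∀ δ ∈ B.trans, g (.trans δ) = f (.trans δ) := fun δ hδ =>
    hfg _ (by simp [parikhVars, hδ])
  have htag : ∀ t ∈ B.tags, g (.tag t) = f (.tag t) := fun t ht => hfg _ (by simp [parikhVars, ht])
  have hinit (q) : g (.init q) = f (.init q) := hfg _ (by simp [parikhVars])
  have hfinal (q) : g (.final q) = f (.final q) := hfg _ (by simp [parikhVars])
  have hspan (q) : g (.span q) = f (.span q) := hfg _ (by simp [parikhVars])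
  have hsum (P : S × Finset T × S → Prop) [DecidablePred P] :
      ∑ δ ∈ B.trans with P δ, g (.trans δ) = ∑ δ ∈ B.trans with P δ, f (.trans δ) :=
    Finset.sum_congr rfl fun δ hδ => htrans δ (Finset.mem_filter.1 hδ).1
  constructor <;> try simp only [hinit, hfinal, hspan, hsum]
  case init_mem => exact h.init_mem
  case init_notMem => exact h.init_notMem
  case sum_init => exact h.sum_init
  case final_mem => exact h.final_mem
  case final_notMem => exact h.final_notMem
  case kirchhoff => exact h.kirchhoff
  case span_eq_zero_iff => exact h.span_eq_zero_iff
  case unvisited =>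
    exact fun q hq => (h.unvisited q hq).imp_right fun h δ hδ hq => (htrans δ hδ).trans (h δ hδ hq)
  case exists_parent =>
    intro q hq
    obtain ⟨δ, hδ, hδq, hpos, hparent⟩ := h.exists_parent q hq
    exact ⟨δ, hδ, hδq, (htrans δ hδ).symm ▸ hpos, hparent⟩
  case trans_nonneg => exact fun δ hδ => (htrans δ hδ).symm ▸ h.trans_nonneg δ hδ
  case tag_eq => exact fun t ht => (htag t ht).trans (h.tag_eq t ht)

end TagAutomaton

/-! ### Runs of the concatenation -/

namespace TransSystem

variable {A Q : Type*} {M : NFA A Q} {ρ ρ₁ ρ₂ : List (Q × A × Q)}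

/-- The transitions, start and accepting states of a nondeterministic finite automaton. -/
def ofNFA (M : NFA A Q) : TransSystem Q A where
  trans := {t | t.2.2 ∈ M.step t.1 t.2.1}
  init := M.start
  final := M.accept

theorem IsAcceptingRun.isRun (h : (ofNFA M).IsAcceptingRun ρ) : M.IsRun ρ := by
  obtain ⟨p, hp, r, -, hρ⟩ := h
  refine ⟨fun t ht => hρ.mem ht, ?_, hρ.isChain⟩
  cases ρ with
  | nil => simp
  | cons t ρ =>
    rintro t ⟨⟩
    exact hρ.2.1 ▸ hp

open scoped Classical in
theorem IsAcceptingRun.eq_of_isFlat (h₁ : (ofNFA M).IsAcceptingRun ρ₁)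
    (h₂ : (ofNFA M).IsAcceptingRun ρ₂) (hM : M.IsFlat)
    (h : ∀ t, occ (fun s => s = t) ρ₁ = occ (fun s => s = t) ρ₂) : ρ₁ = ρ₂ :=
  hM ρ₁ ρ₂ h₁.isRun h₂.isRun (funext fun t =>
    (occ_eq_countP _ _).symm.trans ((h t).trans (occ_eq_countP _ _)))

theorem nonempty_nfaPath_iff {p r : Q} {w : List A} :
    Nonempty (M.Path p r w) ↔ ∃ ρ, IsPath (ofNFA M).trans p ρ r ∧ ρ.map (fun t => t.2.1) = w := by
  constructor
  · rintro ⟨h⟩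
    induction h with
    | nil p => exact ⟨[], rfl, rfl⟩
    | cons q p r a w hq _ ih =>
      obtain ⟨ρ, hρ, rfl⟩ := ih
      exact ⟨(p, a, q) :: ρ, ⟨hq, rfl, hρ⟩, rfl⟩
  · rintro ⟨ρ, hρ, rfl⟩
    induction ρ generalizing p with
    | nil => obtain rfl := isPath_nil.1 hρ; exact ⟨.nil p⟩
    | cons t ρ ih =>
      obtain ⟨ht, rfl, hρ⟩ := hρ
      obtain ⟨h⟩ := ih hρ
      exact ⟨.cons _ _ _ _ _ ht h⟩

theorem mem_accepts_iff {w : List A} :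
    w ∈ M.accepts ↔ ∃ ρ, (ofNFA M).IsAcceptingRun ρ ∧ ρ.map (fun t => t.2.1) = w := by
  rw [NFA.accepts_iff_exists_path]
  simp only [nonempty_nfaPath_iff, IsAcceptingRun]
  constructor
  · rintro ⟨p, hp, r, hr, ρ, hρ, hw⟩
    exact ⟨ρ, ⟨p, hp, r, hr, hρ⟩, hw⟩
  · rintro ⟨ρ, ⟨p, hp, r, hr, hρ⟩, hw⟩
    exact ⟨p, hp, r, hr, ρ, hρ, hw⟩

end TransSystem

namespace NotContains

open TransSystem

/-- A transition of the concatenation of automata with the state sets `Q x`; it is labelled by the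
letter it reads, if any. -/
abbrev Step {X : Type*} (A : Type*) (Q : X → Type*) : Type _ :=
  (Σ x, Q x) × Option A × (Σ x, Q x)

section Concat

variable {A X : Type*} {Q : X → Type*} {x y z : X} {t : Q x × A × Q x} {p r : Σ x, Q x}
  {σ τ : List (Step A Q)}

/-- The transition `t` of the automaton of `x`, as a transition of the concatenation. -/
def letter (x : X) (t : Q x × A × Q x) : Step A Q := (⟨x, t.1⟩, some t.2.1, ⟨x, t.2.2⟩)

/-- The transition from `p` to `r` that reads no letter. -/
def eps (p r : Σ x, Q x) : Step A Q := (p, none, r)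

theorem letter_injective (x : X) : Function.Injective (letter x : Q x × A × Q x → Step A Q) := by
  rintro ⟨q, a, r⟩ ⟨q', a', r'⟩ h
  simpa [letter, Prod.ext_iff] using h

theorem letter_ne_of_ne (h : x ≠ y) (t : Q x × A × Q x) (t' : Q y × A × Q y) :
    letter x t ≠ letter y t' :=
  fun he => h (congrArg (fun s : Step A Q => s.1.1) he)

theorem letter_ne_eps : letter x t ≠ eps p r :=
  fun he => by simpa [letter, eps] using congrArg (fun s : Step A Q => s.2.1) he

/-- The transitions that a path takes in the automaton of `x`. -/
noncomputable def piece (x : X) (σ : List (Step A Q)) : List (Q x × A × Q x) :=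
  σ.filterMap (Function.partialInv (letter x))

@[simp] theorem piece_nil (x : X) : piece x ([] : List (Step A Q)) = [] := rfl

theorem piece_append (x : X) (σ τ : List (Step A Q)) :
    piece x (σ ++ τ) = piece x σ ++ piece x τ :=
  List.filterMap_append

theorem piece_cons_letter (t : Q x × A × Q x) (σ : List (Step A Q)) :
    piece x (letter x t :: σ) = t :: piece x σ :=
  List.filterMap_cons_some (Function.partialInv_left (letter_injective x) t)

theorem piece_cons_of_ne {s : Step A Q} (hs : ∀ t, s ≠ letter x t) :
    piece x (s :: σ) = piece x σ :=
  List.filterMap_cons_none (Option.eq_none_iff_forall_ne_some.2 fun t ht =>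
    hs t (((letter_injective x).isPartialInv t s).1 ht).symm)

theorem piece_cons_letter_of_ne (h : y ≠ x) (t : Q y × A × Q y) (σ : List (Step A Q)) :
    piece x (letter y t :: σ) = piece x σ :=
  piece_cons_of_ne (letter_ne_of_ne h t)

theorem piece_cons_eps (x : X) (p r : Σ x, Q x) (σ : List (Step A Q)) :
    piece x (eps p r :: σ) = piece x σ :=
  piece_cons_of_ne fun _ => letter_ne_eps.symm

theorem piece_map_letter (ρ : List (Q x × A × Q x)) : piece x (ρ.map (letter x)) = ρ := by
  induction ρ with
  | nil => rfl
  | cons t ρ ih => rw [List.map_cons, piece_cons_letter, ih]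

theorem piece_map_letter_of_ne (h : y ≠ x) (ρ : List (Q y × A × Q y)) :
    piece x (ρ.map (letter y)) = [] := by
  induction ρ with
  | nil => rfl
  | cons t ρ ih => rw [List.map_cons, piece_cons_letter_of_ne h, ih]

theorem occ_piece (x : X) (t : Q x × A × Q x) (σ : List (Step A Q)) :
    occ (fun t' => t' = t) (piece x σ) = occ (fun s => s = letter x t) σ := by
  classical
  induction σ with
  | nil => rfl
  | cons s σ ih =>
    by_cases hs : ∃ t', s = letter x t'
    · obtain ⟨t', rfl⟩ := hs
      simp only [piece_cons_letter, occ_cons, ih, (letter_injective x).eq_iff]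
    · push Not at hs
      rw [piece_cons_of_ne hs, ih, occ_cons, if_neg (hs t), zero_add]

theorem exists_split_of_getElem?_piece {k : ℕ} (h : (piece x σ)[k]? = some t) :
    ∃ σ₁ σ₂, σ = σ₁ ++ letter x t :: σ₂ ∧ (piece x σ₁).length = k := by
  obtain ⟨hk, rfl⟩ := List.getElem?_eq_some_iff.1 h
  have hsplit : piece x σ = (piece x σ).take k ++ (piece x σ)[k] :: (piece x σ).drop (k + 1) := by
    rw [List.getElem_cons_drop, List.take_append_drop]
  obtain ⟨σ₁, τ, rfl, h₁, h₂⟩ := List.filterMap_eq_append_iff.1 hsplit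
  obtain ⟨τ₁, s, τ₂, rfl, hτ₁, hs, -⟩ := List.filterMap_eq_cons_iff.1 h₂
  refine ⟨σ₁ ++ τ₁, τ₂, ?_, ?_⟩
  · rw [((letter_injective x).isPartialInv _ _).1 hs]
    simp
  · have hnil : piece x τ₁ = [] := List.filterMap_eq_nil_iff.2 hτ₁
    rw [piece_append, hnil, List.append_nil, piece, h₁, List.length_take]
    exact min_eq_left hk.le

variable [LinearOrder X] {aut : ∀ x, NFA A (Q x)}

/-- The transitions of the concatenation of the automata `aut x` in the order of `X`. -/
inductive IsStep (aut : ∀ x, NFA A (Q x)) : Step A Q → Prop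
  | letter {x : X} {t : Q x × A × Q x} (ht : t ∈ (ofNFA (aut x)).trans) : IsStep aut (letter x t)
  | eps {p r : Σ x, Q x} (hpr : p.1 ⋖ r.1) (hp : p.2 ∈ (aut p.1).accept)
      (hr : r.2 ∈ (aut r.1).start) : IsStep aut (eps p r)

/-- The concatenation of the automata `aut x` in the order of `X`. -/
def concat (aut : ∀ x, NFA A (Q x)) : TransSystem (Σ x, Q x) (Option A) where
  trans := {s | IsStep aut s}
  init := {p | IsBot p.1 ∧ p.2 ∈ (aut p.1).start}
  final := {r | IsTop r.1 ∧ r.2 ∈ (aut r.1).accept}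

theorem letter_mem_trans_concat : letter x t ∈ (concat aut).trans ↔ t ∈ (ofNFA (aut x)).trans := by
  refine ⟨fun h => ?_, .letter⟩
  generalize hs : letter x t = s at h
  rcases (h : IsStep aut s) with @⟨y, t', ht⟩ | _
  · obtain rfl : x = y := by
      by_contra hne
      exact letter_ne_of_ne hne _ _ hs
    rwa [letter_injective x hs]
  · exact absurd hs letter_ne_eps

theorem IsStep.le {s : Step A Q} (hs : IsStep aut s) : s.1.1 ≤ s.2.2.1 := by
  cases hs with
  | letter ht => exact le_rfl
  | eps hpr => exact hpr.le

theorem length_piece {σ : List (Step A Q)} (hσ : ∀ s ∈ σ, IsStep aut s) (x : X) :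
    (piece x σ).length = occ (fun s => s.2.1.isSome ∧ s.1.1 = x) σ := by
  classical
  induction σ with
  | nil => rfl
  | cons s σ ih =>
    obtain ⟨hs, hσ⟩ := List.forall_mem_cons.1 hσ
    rw [occ_cons, ← ih hσ]
    rcases hs with @⟨y, t, ht⟩ | _
    · by_cases hyx : y = x
      · subst hyx
        rw [piece_cons_letter, if_pos ⟨rfl, rfl⟩, List.length_cons, add_comm]
      · rw [piece_cons_letter_of_ne hyx, if_neg fun h => hyx h.2, zero_add]
    · rw [piece_cons_eps, if_neg fun h => Bool.false_ne_true h.1, zero_add]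

theorem path_le (h : IsPath (concat aut).trans p σ r) : p.1 ≤ r.1 := by
  induction σ generalizing p with
  | nil => exact (congrArg Sigma.fst h).le
  | cons s σ ih =>
    obtain ⟨hs, rfl, h⟩ := h
    exact hs.le.trans (ih h)

theorem piece_eq_nil_of_lt (h : IsPath (concat aut).trans p σ r) (hz : z < p.1 ∨ r.1 < z) :
    piece z σ = [] := by
  induction σ generalizing p with
  | nil => rfl
  | cons s σ ih =>
    have hle := path_le h
    obtain ⟨hs, rfl, h⟩ := h
    have htail := ih h (hz.imp_left fun hz => hz.trans_le hs.le)
    rw [piece_cons_of_ne, htail]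
    rintro t rfl
    exact hz.elim (lt_irrefl z) hle.not_gt

theorem path_piece (h : IsPath (concat aut).trans p σ r) (hpz : p.1 ≤ z) (hzr : z ≤ r.1) :
    ∃ s e, (p = ⟨z, s⟩ ∨ p.1 < z ∧ s ∈ (aut z).start) ∧
      (r = ⟨z, e⟩ ∨ z < r.1 ∧ e ∈ (aut z).accept) ∧
      IsPath (ofNFA (aut z)).trans s (piece z σ) e := by
  induction σ generalizing p with
  | nil =>
    obtain rfl := isPath_nil.1 h
    obtain rfl := le_antisymm hpz hzr
    exact ⟨p.2, p.2, .inl rfl, .inl rfl, rfl⟩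
  | cons s σ ih =>
    obtain ⟨hs, rfl, h⟩ := h
    rcases (hs : IsStep aut s) with @⟨y, t, ht⟩ | @⟨p, r', hcov, hacc, hst⟩
    · obtain ⟨s, e, hs, he, hpath⟩ := ih h hpz
      by_cases hyz : y = z
      · subst hyz
        obtain rfl : t.2.2 = s := by
          rcases hs with hs | hs
          exacts [eq_of_heq (Sigma.mk.inj hs).2, (lt_irrefl _ hs.1).elim]
        rw [piece_cons_letter]
        exact ⟨t.1, e, .inl rfl, he, ht, rfl, hpath⟩
      · rw [piece_cons_letter_of_ne hyz]
        refine ⟨s, e, .inr (hs.resolve_left fun hs => hyz (congrArg Sigma.fst hs)), he, hpath⟩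
    · rw [piece_cons_eps]
      rcases eq_or_lt_of_le (show p.1 ≤ z from hpz) with rfl | hlt
      · rw [piece_eq_nil_of_lt h (.inl hcov.lt)]
        exact ⟨p.2, p.2, .inl rfl, .inr ⟨hcov.lt.trans_le (path_le h), hacc⟩, rfl⟩
      · obtain ⟨s, e, hs, he, hpath⟩ := ih h (hcov.ge_of_gt hlt)
        refine ⟨s, e, .inr ⟨hlt, ?_⟩, he, hpath⟩
        rcases hs with hs | hs
        · obtain rfl : r' = ⟨z, s⟩ := hs
          exact hst
        · exact hs.2

theorem isAcceptingRun_piece (h : (concat aut).IsAcceptingRun σ) (z : X) :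
    (ofNFA (aut z)).IsAcceptingRun (piece z σ) := by
  obtain ⟨p, hp, r, hr, h⟩ := h
  obtain ⟨s, e, hs, he, hpath⟩ := path_piece h (hp.1 z) (hr.1 z)
  refine ⟨s, ?_, e, ?_, hpath⟩
  · rcases hs with rfl | hs
    exacts [hp.2, hs.2]
  · rcases he with rfl | he
    exacts [hr.2, he.2]

theorem isPath_map_letter {p r : Q x} {ρ : List (Q x × A × Q x)}
    (h : IsPath (ofNFA (aut x)).trans p ρ r) :
    IsPath (concat aut).trans ⟨x, p⟩ (ρ.map (letter x)) ⟨x, r⟩ :=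
  h.map (g := Sigma.mk x) fun _ ht => ⟨.letter ht, rfl, rfl⟩

theorem exists_isPath_concat {b : X} (hb : IsBot b) [Finite X] {s e : ∀ x, Q x}
    {R : ∀ x, List (Q x × A × Q x)} (hs : ∀ x, s x ∈ (aut x).start)
    (he : ∀ x, e x ∈ (aut x).accept) (hR : ∀ x, IsPath (ofNFA (aut x)).trans (s x) (R x) (e x))
    (y : X) :
    ∃ σ, IsPath (concat aut).trans ⟨b, s b⟩ σ ⟨y, e y⟩ ∧ ∀ z ≤ y, piece z σ = R z := by
  induction y using WellFoundedLT.induction with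
  | ind y ih =>
    by_cases hy : y = b
    · subst hy
      refine ⟨_, isPath_map_letter (hR y), fun z hz => ?_⟩
      obtain rfl := le_antisymm hz (hb z)
      exact piece_map_letter _
    · obtain ⟨x, -, hxy⟩ := exists_le_covBy_of_lt (lt_of_le_of_ne (hb y) (Ne.symm hy))
      obtain ⟨σ, hσ, hpiece⟩ := ih x hxy.lt
      refine ⟨σ ++ eps ⟨x, e x⟩ ⟨y, s y⟩ :: (R y).map (letter y), isPath_append.2
        ⟨_, hσ, .eps hxy (he x) (hs y), rfl, isPath_map_letter (hR y)⟩, fun z hz => ?_⟩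
      rw [piece_append, piece_cons_eps]
      rcases eq_or_lt_of_le hz with rfl | hlt
      · rw [piece_eq_nil_of_lt hσ (.inr hxy.lt), piece_map_letter, List.nil_append]
      · rw [hpiece z (hxy.le_of_lt hlt), piece_map_letter_of_ne hlt.ne', List.append_nil]

theorem exists_isAcceptingRun_concat [Finite X] [Nonempty X] {R : ∀ x, List (Q x × A × Q x)}
    (hR : ∀ x, (ofNFA (aut x)).IsAcceptingRun (R x)) :
    ∃ σ, (concat aut).IsAcceptingRun σ ∧ ∀ x, piece x σ = R x := by
  choose s hs e he hpath using hR
  obtain ⟨b, hb : IsBot b⟩ := Finite.exists_min (id : X → X)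
  obtain ⟨t, ht : IsTop t⟩ := Finite.exists_max (id : X → X)
  obtain ⟨σ, hσ, hpiece⟩ := exists_isPath_concat hb hs he hpath t
  exact ⟨σ, ⟨⟨b, s b⟩, ⟨hb, hs b⟩, ⟨t, e t⟩, ⟨ht, he t⟩, hσ⟩, fun x => hpiece x (ht x)⟩

end Concat

end NotContains

/-! ### Runs of the three copies -/

namespace NotContains

open TransSystem

/-- The type of transitions of the three copies of the concatenation. -/
abbrev CopyTrans {X : Type*} (A : Type*) (Q : X → Type*) : Type _ :=
  ((Σ x, Q x) × Fin 3) × Finset (Tag A X) × ((Σ x, Q x) × Fin 3)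

section Tagging

variable {A X : Type*} {Q : X → Type*}

open scoped Classical in
/-- The transition of the tag automaton of the concatenation that represents `s`. -/
noncomputable def tagged (s : Step A Q) : (Σ x, Q x) × Finset (Tag A X) × (Σ x, Q x) :=
  (s.1, match s.2.1 with | none => ∅ | some a => {.sym a, .len s.1.1}, s.2.2)

/-- The position tag of the copy `i`. -/
def posTag (i : Fin 3) (x : X) : Tag A X :=
  ![.pos₁ x, .pos₂ x, .pos₃ x] i

open scoped Classical in
/-- The transition that represents `s` within the copy `i`. -/
noncomputable def lift (i : Fin 3) (s : Step A Q) : CopyTrans A Q :=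
  ((s.1, i), match s.2.1 with | none => ∅ | some a => {.sym a, posTag i s.1.1, .len s.1.1},
    (s.2.2, i))

open scoped Classical in
/-- The transition from copy `0` to copy `1` that takes `t` and samples the first mismatch. -/
noncomputable def mark₁ (x : X) (t : Q x × A × Q x) : CopyTrans A Q :=
  ((⟨x, t.1⟩, 0), {.sym t.2.1, .mis₁ t.2.1 x, .pos₂ x, .len x}, (⟨x, t.2.2⟩, 1))

open scoped Classical in
/-- The transition from copy `1` to copy `2` that takes `t` and samples the second mismatch. -/
noncomputable def mark₂ (x : X) (t : Q x × A × Q x) : CopyTrans A Q :=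
  ((⟨x, t.1⟩, 1), {.sym t.2.1, .mis₂ t.2.1 x, .pos₃ x, .len x}, (⟨x, t.2.2⟩, 2))

/-- `δ` is one of the transitions of the three copies that represent the transition `t` of the
automaton of `x`. -/
def IsCopyOf (x : X) (t : Q x × A × Q x) (δ : CopyTrans A Q) : Prop :=
  δ.1.1 = ⟨x, t.1⟩ ∧ δ.2.2.1 = ⟨x, t.2.2⟩ ∧ .sym t.2.1 ∈ δ.2.1

variable (i j : Fin 3) (x y : X) (s : Step A Q) (t : Q x × A × Q x) (t' : Q y × A × Q y) (a : A)

theorem len_mem_lift : Tag.len x ∈ (lift i s).2.1 ↔ s.2.1.isSome ∧ s.1.1 = x := by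
  obtain ⟨p, _ | a, r⟩ := s
  · simp [lift]
  · fin_cases i <;> simp [lift, posTag, eq_comm]

theorem posTag_mem_lift :
    posTag j x ∈ (lift i s).2.1 ↔ i = j ∧ s.2.1.isSome ∧ s.1.1 = x := by
  obtain ⟨p, _ | a, r⟩ := s
  · simp [lift]
  · fin_cases i <;> fin_cases j <;> simp [lift, posTag, eq_comm]

theorem mis₁_notMem_lift : Tag.mis₁ a x ∉ (lift i s).2.1 := by
  obtain ⟨p, _ | b, r⟩ := s
  · simp [lift]
  · fin_cases i <;> simp [lift, posTag]

theorem mis₂_notMem_lift : Tag.mis₂ a x ∉ (lift i s).2.1 := by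
  obtain ⟨p, _ | b, r⟩ := s
  · simp [lift]
  · fin_cases i <;> simp [lift, posTag]

theorem isCopyOf_lift : IsCopyOf x t (lift i s) ↔ s = letter x t := by
  obtain ⟨p, _ | b, r⟩ := s
  · simp [lift, IsCopyOf, letter]
  · fin_cases i <;> simp [lift, IsCopyOf, letter, posTag, Prod.ext_iff] <;> tauto

variable {x y}

theorem isCopyOf_mark₁ : IsCopyOf x t (mark₁ y t') ↔ letter y t' = letter x t := by
  simp only [IsCopyOf, mark₁, letter, Prod.ext_iff]
  simp
  tauto

theorem isCopyOf_mark₂ : IsCopyOf x t (mark₂ y t') ↔ letter y t' = letter x t := by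
  simp only [IsCopyOf, mark₂, letter, Prod.ext_iff]
  simp
  tauto

end Tagging

section Mem

variable {A X : Type*} [Fintype A] [Fintype X] [LinearOrder X] {Q : X → Type*}
  [∀ x, Fintype (Q x)] (aut : ∀ x, NFA A (Q x))

/-- The tag automaton of the concatenation, denoted by `C` in the paper. -/
noncomputable abbrev concatAut : TagAutomaton (Tag A X) (Σ x, Q x) :=
  epsConcat fun x => lenTag x (aut x)

/-- The tag automaton that samples two mismatching positions, denoted by `T` in the paper. -/
noncomputable abbrev samplingAut : TagAutomaton (Tag A X) ((Σ x, Q x) × Fin 3) :=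
  threeCopies (concatAut aut)

variable {aut}

theorem mem_concatAut_trans {δ} :
    δ ∈ (concatAut aut).trans ↔ ∃ s : Step A Q, IsStep aut s ∧ δ = tagged s := by
  classical
  simp only [epsConcat, lenTag, Finset.mem_union, Finset.mem_biUnion, Finset.mem_univ, true_and,
    Finset.mem_image, Finset.mem_filter]
  constructor
  · rintro (⟨x, _, ⟨t, ht, rfl⟩, rfl⟩ | ⟨⟨p, r⟩, ⟨hpr, hp, hr⟩, rfl⟩)
    · exact ⟨letter x t, .letter ht, by simp [tagged, letter]⟩
    · exact ⟨eps p r, .eps hpr hp hr, rfl⟩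
  · rintro ⟨_, @⟨x, t, ht⟩ | @⟨p, r, hpr, hp, hr⟩, rfl⟩
    · exact .inl ⟨x, _, ⟨t, ht, rfl⟩, by simp [tagged, letter]⟩
    · exact .inr ⟨(p, r), ⟨hpr, hp, hr⟩, rfl⟩

theorem mem_letterTrans {a : A} {x : X} {δ} : δ ∈ letterTrans (concatAut aut) a x ↔
    ∃ t ∈ (ofNFA (aut x)).trans, t.2.1 = a ∧ δ = tagged (letter x t) := by
  classical
  rw [letterTrans, Finset.mem_filter, mem_concatAut_trans]
  constructor
  · rintro ⟨⟨_, @⟨y, t, ht⟩ | _, rfl⟩, h⟩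
    · have hsym : Tag.sym t.2.1 ∈ ({.sym a, .len x} : Finset (Tag A X)) := by
        rw [← h]; simp [tagged, letter]
      have hlen : Tag.len y ∈ ({.sym a, .len x} : Finset (Tag A X)) := by
        rw [← h]; simp [tagged, letter]
      obtain rfl : y = x := by simpa using hlen
      exact ⟨t, ht, by simpa using hsym, rfl⟩
    · exact absurd h.symm (Finset.insert_ne_empty _ _)
  · rintro ⟨t, ht, rfl, rfl⟩
    exact ⟨⟨_, .letter ht, rfl⟩, by simp [tagged, letter]⟩

theorem mem_samplingAut_trans {δ : CopyTrans A Q} : δ ∈ (samplingAut aut).trans ↔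
    (∃ s i, IsStep aut s ∧ δ = lift i s) ∨
      ∃ x, ∃ t ∈ (ofNFA (aut x)).trans, δ = mark₁ x t ∨ δ = mark₂ x t := by
  classical
  simp only [threeCopies, Finset.mem_union, Finset.mem_biUnion, Finset.mem_univ, true_and,
    mem_letterTrans, Finset.mem_image, Finset.mem_filter, mem_concatAut_trans,
    Finset.mem_insert, Finset.mem_singleton]
  constructor
  · rintro (⟨⟨a, x⟩, _, ⟨⟨q, b, r⟩, ht, hba, rfl⟩, hδ⟩ | ⟨_, ⟨⟨s, hs, rfl⟩, hempty⟩, i, rfl⟩)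
    · obtain rfl : b = a := hba
      rcases hδ with rfl | rfl | rfl | rfl | rfl
      exacts [.inl ⟨_, 0, .letter ht, rfl⟩, .inr ⟨x, _, ht, .inl rfl⟩,
        .inl ⟨_, 1, .letter ht, rfl⟩, .inr ⟨x, _, ht, .inr rfl⟩, .inl ⟨_, 2, .letter ht, rfl⟩]
    · rcases hs with _ | ⟨hpr, hp, hr⟩
      · exact absurd hempty (Finset.insert_ne_empty _ _)
      · exact .inl ⟨_, i, .eps hpr hp hr, rfl⟩
  · rintro (⟨s, i, @⟨x, t, ht⟩ | ⟨hpr, hp, hr⟩, rfl⟩ | ⟨x, t, ht, rfl | rfl⟩)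
    · refine .inl ⟨(t.2.1, x), _, ⟨t, ht, rfl, rfl⟩, ?_⟩
      fin_cases i
      exacts [.inl rfl, .inr (.inr (.inl rfl)), .inr (.inr (.inr (.inr rfl)))]
    · exact .inr ⟨_, ⟨⟨_, .eps hpr hp hr, rfl⟩, rfl⟩, i, rfl⟩
    · exact .inl ⟨(t.2.1, x), _, ⟨t, ht, rfl, rfl⟩, .inr (.inl rfl)⟩
    · exact .inl ⟨(t.2.1, x), _, ⟨t, ht, rfl, rfl⟩, .inr (.inr (.inr (.inl rfl)))⟩

theorem mem_samplingAut_tags [Nonempty X] (t : Tag A X) : t ∈ (samplingAut aut).tags := by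
  classical
  cases t <;> simp [threeCopies, epsConcat, lenTag]

theorem mem_samplingAut_init {p : (Σ x, Q x) × Fin 3} :
    p ∈ (samplingAut aut).init ↔ p.1 ∈ (concat aut).init ∧ p.2 = 0 := by
  classical
  obtain ⟨⟨x, q⟩, i⟩ := p
  simp [threeCopies, epsConcat, lenTag, concat, -Finset.product_singleton]

theorem mem_samplingAut_final {p : (Σ x, Q x) × Fin 3} :
    p ∈ (samplingAut aut).final ↔ p.1 ∈ (concat aut).final ∧ (p.2 = 0 ∨ p.2 = 2) := by
  classical
  obtain ⟨⟨x, q⟩, i⟩ := p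
  simp [threeCopies, epsConcat, lenTag, concat]

end Mem

section Runs

variable {A X : Type*} {Q : X → Type*}

/-- A path of the concatenation with two marked letters, of the automata of `x₁` and `x₂`. -/
structure MarkedPath (A : Type*) {X : Type*} (Q : X → Type*) where
  pre : List (Step A Q)
  x₁ : X
  t₁ : Q x₁ × A × Q x₁
  mid : List (Step A Q)
  x₂ : X
  t₂ : Q x₂ × A × Q x₂
  post : List (Step A Q)

/-- The run `ρ` of the three copies takes the same transitions, equally often, as the runs `R x` of
the automata. -/
structure Describes (ρ : List (CopyTrans A Q)) (R : ∀ x, List (Q x × A × Q x)) : Prop where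
  len : ∀ x, occ (fun δ => Tag.len x ∈ δ.2.1) ρ = (R x).length
  copy : ∀ x t, occ (IsCopyOf x t) ρ = occ (fun t' => t' = t) (R x)

open scoped Classical in
/-- The tags of `ρ` mark the letter `a₁` at position `k₁` of `w x₁` as the first mismatch and the
letter `a₂` at position `k₂` of `w x₂` as the second mismatch. -/
structure Samples [Preorder X] (ρ : List (CopyTrans A Q)) (w : X → List A)
    (x₁ : X) (a₁ : A) (k₁ : ℕ) (x₂ : X) (a₂ : A) (k₂ : ℕ) : Prop where
  le : x₁ ≤ x₂
  letter₁ : (w x₁)[k₁]? = some a₁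
  letter₂ : (w x₂)[k₂]? = some a₂
  mis₁ : ∀ a x, occ (fun δ => Tag.mis₁ a x ∈ δ.2.1) ρ = if a = a₁ ∧ x = x₁ then 1 else 0
  mis₂ : ∀ a x, occ (fun δ => Tag.mis₂ a x ∈ δ.2.1) ρ = if a = a₂ ∧ x = x₂ then 1 else 0
  pos₁ : occ (fun δ => Tag.pos₁ x₁ ∈ δ.2.1) ρ = k₁
  pos₂ : occ (fun δ => Tag.pos₁ x₂ ∈ δ.2.1) ρ + occ (fun δ => Tag.pos₂ x₂ ∈ δ.2.1) ρ = k₂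
  pos₁_eq_zero : x₁ < x₂ → occ (fun δ => Tag.pos₁ x₂ ∈ δ.2.1) ρ = 0

/-- The words read by the runs `R x`. -/
def words (R : ∀ x, List (Q x × A × Q x)) (x : X) : List A :=
  (R x).map fun t => t.2.1

namespace MarkedPath

variable (W : MarkedPath A Q)

/-- The path without the marks. -/
def path : List (Step A Q) :=
  W.pre ++ letter W.x₁ W.t₁ :: (W.mid ++ letter W.x₂ W.t₂ :: W.post)

/-- The path through the three copies that changes the copy at the two marked letters. -/
noncomputable def run : List (CopyTrans A Q) :=
  W.pre.map (lift 0) ++ mark₁ W.x₁ W.t₁ :: (W.mid.map (lift 1) ++ mark₂ W.x₂ W.t₂ ::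
    W.post.map (lift 2))

theorem piece_path_getElem?_fst :
    (piece W.x₁ W.path)[(piece W.x₁ W.pre).length]? = some W.t₁ := by
  rw [path, piece_append, piece_cons_letter]
  simp

theorem piece_path_getElem?_snd :
    (piece W.x₂ W.path)[(piece W.x₂ (W.pre ++ letter W.x₁ W.t₁ :: W.mid)).length]? =
      some W.t₂ := by
  rw [path, ← List.cons_append, ← List.append_assoc, piece_append, piece_cons_letter]
  simp

end MarkedPath

variable [LinearOrder X] {aut : ∀ x, NFA A (Q x)} {σ : List (Step A Q)}

open scoped Classical in
theorem describes_map_lift (hσ : ∀ s ∈ σ, IsStep aut s) :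
    Describes (σ.map (lift 0)) fun x => piece x σ where
  len x := by simp only [occ_map, len_mem_lift, length_piece hσ]
  copy x t := by simp only [occ_map, isCopyOf_lift, occ_piece]

namespace MarkedPath

variable {W : MarkedPath A Q}

open scoped Classical in
theorem describes_run (hW : ∀ s ∈ W.path, IsStep aut s) :
    Describes W.run fun x => piece x W.path where
  len x := by
    rw [length_piece hW]
    simp [run, path, occ_append, occ_cons, occ_map, len_mem_lift, mark₁, mark₂, letter,
      @eq_comm _ x]
  copy x t := by
    simp only [occ_piece, run, path, occ_append, occ_cons, occ_map, isCopyOf_lift, isCopyOf_mark₁,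
      isCopyOf_mark₂]

open scoped Classical in
theorem occ_pos₁_run (hW : ∀ s ∈ W.path, IsStep aut s) (x : X) :
    occ (fun δ => Tag.pos₁ x ∈ δ.2.1) W.run = (piece x W.pre).length := by
  rw [length_piece fun s hs => hW s (List.mem_append_left _ hs)]
  have hlift (i s) := posTag_mem_lift i 0 x (s : Step A Q)
  simp only [show posTag 0 x = (Tag.pos₁ x : Tag A X) from rfl] at hlift
  simp [run, occ_append, occ_cons, occ_map, hlift, mark₁, mark₂]

open scoped Classical in
theorem occ_pos₂_run (hW : ∀ s ∈ W.path, IsStep aut s) (x : X) :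
    occ (fun δ => Tag.pos₂ x ∈ δ.2.1) W.run =
      (piece x (letter W.x₁ W.t₁ :: W.mid)).length := by
  have hmid : ∀ s ∈ letter W.x₁ W.t₁ :: W.mid, IsStep aut s := fun s hs =>
    hW s (List.mem_append_right _ (List.mem_append_left (as := _ :: _) _ hs))
  rw [length_piece hmid]
  have hlift (i s) := posTag_mem_lift i 1 x (s : Step A Q)
  simp only [show posTag 1 x = (Tag.pos₂ x : Tag A X) from rfl] at hlift
  simp [run, occ_append, occ_cons, occ_map, hlift, mark₁, mark₂, letter,
      @eq_comm _ x]

open scoped Classical in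
theorem samples_run {p r : Σ x, Q x} (h : IsPath (concat aut).trans p W.path r) :
    Samples W.run (words fun x => piece x W.path) W.x₁ W.t₁.2.1 (piece W.x₁ W.pre).length
      W.x₂ W.t₂.2.1 (piece W.x₂ (W.pre ++ letter W.x₁ W.t₁ :: W.mid)).length where
  le := by
    obtain ⟨_, -, -, rfl, h⟩ := isPath_append.1 h
    obtain ⟨_, hmid, -, rfl, -⟩ := isPath_append.1 h
    exact path_le hmid
  letter₁ := by rw [words, List.getElem?_map, piece_path_getElem?_fst, Option.map_some]
  letter₂ := by rw [words, List.getElem?_map, piece_path_getElem?_snd, Option.map_some]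
  mis₁ a x := by
      simp [run, occ_append, occ_cons, occ_map, mis₁_notMem_lift, mark₁, mark₂]
  mis₂ a x := by
      simp [run, occ_append, occ_cons, occ_map, mis₂_notMem_lift, mark₁, mark₂]
  pos₁ := occ_pos₁_run (fun s => h.mem) _
  pos₂ := by
    rw [occ_pos₁_run fun s => h.mem, occ_pos₂_run fun s => h.mem, piece_append,
      List.length_append]
  pos₁_eq_zero hlt := by
    obtain ⟨q, hq, -, rfl, -⟩ := isPath_append.1 h
    rw [occ_pos₁_run fun s => h.mem, piece_eq_nil_of_lt hq (.inr hlt), List.length_nil]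

theorem exists_path_eq {p r : Σ x, Q x} (h : IsPath (concat aut).trans p σ r) {x₁ x₂ : X}
    {k₁ k₂ : ℕ} {t₁ t₂} (h₁ : (piece x₁ σ)[k₁]? = some t₁) (h₂ : (piece x₂ σ)[k₂]? = some t₂)
    (hlt : x₁ < x₂ ∨ x₁ = x₂ ∧ k₁ < k₂) :
    ∃ σ₁ σ₂ σ₃, (MarkedPath.mk σ₁ x₁ t₁ σ₂ x₂ t₂ σ₃).path = σ ∧ (piece x₁ σ₁).length = k₁ ∧
      (piece x₂ (σ₁ ++ letter x₁ t₁ :: σ₂)).length = k₂ := by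
  obtain ⟨σ₁, τ, rfl, rfl⟩ := exists_split_of_getElem?_piece h₁
  obtain ⟨q, hq, hτ⟩ := isPath_append.1 h
  have hle : (piece x₂ (σ₁ ++ [letter x₁ t₁])).length ≤ k₂ := by
    rcases hlt with hlt | ⟨rfl, hlt⟩
    · rw [piece_append, piece_eq_nil_of_lt hq (.inr (hτ.2.1 ▸ hlt)),
        piece_cons_letter_of_ne hlt.ne]
      exact Nat.zero_le _
    · rw [piece_append, piece_cons_letter]
      simpa using hlt
  rw [← List.singleton_append, ← List.append_assoc, piece_append,
    List.getElem?_append_right hle] at h₂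
  obtain ⟨σ₂, σ₃, rfl, hk₂⟩ := exists_split_of_getElem?_piece h₂
  refine ⟨σ₁, σ₂, σ₃, rfl, rfl, ?_⟩
  rw [← List.singleton_append, ← List.append_assoc, piece_append, List.length_append, hk₂]
  omega

end MarkedPath

end Runs

section Correspondence

variable {A X : Type*} [Fintype A] [Fintype X] [LinearOrder X] {Q : X → Type*}
  [∀ x, Fintype (Q x)] {aut : ∀ x, NFA A (Q x)} {σ : List (Step A Q)}
  {ρ : List (CopyTrans A Q)} {p r : Σ x, Q x} {r' : (Σ x, Q x) × Fin 3}

theorem isPath_map_lift (i : Fin 3) (h : IsPath (concat aut).trans p σ r) :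
    IsPath (samplingAut aut).trans (p, i) (σ.map (lift i)) (r, i) :=
  h.map (g := fun q => (q, i)) fun s hs =>
    ⟨mem_samplingAut_trans.2 (.inl ⟨s, i, hs, rfl⟩), rfl, rfl⟩

theorem MarkedPath.isPath_run {W : MarkedPath A Q} (h : IsPath (concat aut).trans p W.path r) :
    IsPath (samplingAut aut).trans (p, 0) W.run (r, 2) := by
  obtain ⟨q₁, hpre, ht₁, rfl, h⟩ := isPath_append.1 h
  obtain ⟨q₂, hmid, ht₂, rfl, hpost⟩ := isPath_append.1 h
  rw [letter_mem_trans_concat] at ht₁ ht₂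
  exact isPath_append.2 ⟨_, isPath_map_lift 0 hpre,
    mem_samplingAut_trans.2 (.inr ⟨_, _, ht₁, .inl rfl⟩), rfl,
    isPath_append.2 ⟨_, isPath_map_lift 1 hmid,
      mem_samplingAut_trans.2 (.inr ⟨_, _, ht₂, .inr rfl⟩), rfl, isPath_map_lift 2 hpost⟩⟩

theorem exists_eq_map_lift_two (h : IsPath (samplingAut aut).trans (p, 2) ρ r') :
    ∃ σ, ρ = σ.map (lift 2) ∧ IsPath (concat aut).trans p σ r'.1 := by
  induction ρ generalizing p with
  | nil => exact ⟨[], rfl, congrArg Prod.fst h⟩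
  | cons δ ρ ih =>
    obtain ⟨hδ, hp, h⟩ := h
    rcases mem_samplingAut_trans.1 hδ with ⟨s, i, hs, rfl⟩ | ⟨x, t, -, rfl | rfl⟩
    · obtain ⟨rfl, rfl⟩ := Prod.mk.inj hp
      obtain ⟨σ, rfl, hσ⟩ := ih h
      exact ⟨s :: σ, rfl, hs, rfl, hσ⟩
    · simp [mark₁] at hp
    · simp [mark₂] at hp

theorem exists_eq_of_isPath_one (h : IsPath (samplingAut aut).trans (p, 1) ρ r')
    (hr : r'.2 ≠ 1) :
    ∃ (σ₂ : List (Step A Q)) (x₂ : X) (t₂ : Q x₂ × A × Q x₂) (σ₃ : List (Step A Q)),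
      ρ = σ₂.map (lift 1) ++ mark₂ x₂ t₂ :: σ₃.map (lift 2) ∧
      IsPath (concat aut).trans p (σ₂ ++ letter x₂ t₂ :: σ₃) r'.1 := by
  induction ρ generalizing p with
  | nil => exact absurd (congrArg Prod.snd h).symm hr
  | cons δ ρ ih =>
    obtain ⟨hδ, hp, h⟩ := h
    rcases mem_samplingAut_trans.1 hδ with ⟨s, i, hs, rfl⟩ | ⟨x, t, ht, rfl | rfl⟩
    · obtain ⟨rfl, rfl⟩ := Prod.mk.inj hp
      obtain ⟨σ₂, x₂, t₂, σ₃, rfl, hσ⟩ := ih h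
      exact ⟨s :: σ₂, x₂, t₂, σ₃, rfl, hs, rfl, hσ⟩
    · simp [mark₁] at hp
    · obtain ⟨σ₃, rfl, hσ⟩ := exists_eq_map_lift_two h
      exact ⟨[], x, t, σ₃, rfl, .letter ht, congrArg Prod.fst hp, hσ⟩

theorem exists_eq_of_isPath_zero (h : IsPath (samplingAut aut).trans (p, 0) ρ r')
    (hr : r'.2 ≠ 1) :
    (∃ σ, ρ = σ.map (lift 0) ∧ IsPath (concat aut).trans p σ r'.1) ∨
      ∃ W : MarkedPath A Q, ρ = W.run ∧ IsPath (concat aut).trans p W.path r'.1 := by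
  induction ρ generalizing p with
  | nil => exact .inl ⟨[], rfl, congrArg Prod.fst h⟩
  | cons δ ρ ih =>
    obtain ⟨hδ, hp, h⟩ := h
    rcases mem_samplingAut_trans.1 hδ with ⟨s, i, hs, rfl⟩ | ⟨x, t, ht, rfl | rfl⟩
    · obtain ⟨rfl, rfl⟩ := Prod.mk.inj hp
      rcases ih h with ⟨σ, rfl, hσ⟩ | ⟨W, rfl, hW⟩
      · exact .inl ⟨s :: σ, rfl, hs, rfl, hσ⟩
      · exact .inr ⟨{ W with pre := s :: W.pre }, rfl, hs, rfl, hW⟩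
    · obtain ⟨σ₂, x₂, t₂, σ₃, rfl, hσ⟩ := exists_eq_of_isPath_one h hr
      exact .inr ⟨⟨[], x, t, σ₂, x₂, t₂, σ₃⟩, rfl, .letter ht, congrArg Prod.fst hp, hσ⟩
    · simp [mark₂] at hp

open scoped Classical in
theorem exists_describes (h : (samplingAut aut).toTransSystem.IsAcceptingRun ρ) :
    ∃ R, (∀ x, (ofNFA (aut x)).IsAcceptingRun (R x)) ∧ Describes ρ R ∧
      ((∀ a x, occ (fun δ => Tag.mis₁ a x ∈ δ.2.1) ρ = 0) ∨
        ∃ x₁ a₁ k₁ x₂ a₂ k₂, Samples ρ (words R) x₁ a₁ k₁ x₂ a₂ k₂) := by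
  obtain ⟨⟨p, i⟩, hp, r', hr, h⟩ := h
  obtain ⟨hp, rfl⟩ := mem_samplingAut_init.1 hp
  obtain ⟨hr, hri⟩ := mem_samplingAut_final.1 hr
  rcases exists_eq_of_isPath_zero h (by rcases hri with h | h <;> simp [h]) with
    ⟨σ, rfl, hσ⟩ | ⟨W, rfl, hW⟩
  · refine ⟨_, isAcceptingRun_piece ⟨p, hp, _, hr, hσ⟩, describes_map_lift fun s => hσ.mem,
      .inl fun a x => ?_⟩
    simp only [occ_map, mis₁_notMem_lift, occ_false]
  · exact ⟨_, isAcceptingRun_piece ⟨p, hp, _, hr, hW⟩, W.describes_run fun s => hW.mem,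
      .inr ⟨_, _, _, _, _, _, W.samples_run hW⟩⟩

variable [Nonempty X] {R : ∀ x, List (Q x × A × Q x)}

theorem exists_isAcceptingRun_describes (hR : ∀ x, (ofNFA (aut x)).IsAcceptingRun (R x)) :
    ∃ ρ, (samplingAut aut).toTransSystem.IsAcceptingRun ρ ∧ Describes ρ R := by
  obtain ⟨σ, ⟨p, hp, r, hr, hσ⟩, hpiece⟩ := exists_isAcceptingRun_concat hR
  obtain rfl := funext hpiece
  exact ⟨_, ⟨(p, 0), mem_samplingAut_init.2 ⟨hp, rfl⟩, (r, 0),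
    mem_samplingAut_final.2 ⟨hr, .inl rfl⟩, isPath_map_lift 0 hσ⟩,
    describes_map_lift fun s => hσ.mem⟩

theorem exists_isAcceptingRun_samples (hR : ∀ x, (ofNFA (aut x)).IsAcceptingRun (R x))
    {x₁ x₂ : X} {k₁ k₂ : ℕ} {a₁ a₂ : A} (h₁ : (words R x₁)[k₁]? = some a₁)
    (h₂ : (words R x₂)[k₂]? = some a₂) (hlt : x₁ < x₂ ∨ x₁ = x₂ ∧ k₁ < k₂) :
    ∃ ρ, (samplingAut aut).toTransSystem.IsAcceptingRun ρ ∧ Describes ρ R ∧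
      Samples ρ (words R) x₁ a₁ k₁ x₂ a₂ k₂ := by
  obtain ⟨σ, ⟨p, hp, r, hr, hσ⟩, hpiece⟩ := exists_isAcceptingRun_concat hR
  obtain rfl := funext hpiece
  rw [words, List.getElem?_map, Option.map_eq_some_iff] at h₁ h₂
  obtain ⟨t₁, h₁, rfl⟩ := h₁
  obtain ⟨t₂, h₂, rfl⟩ := h₂
  obtain ⟨σ₁, σ₂, σ₃, rfl, rfl, rfl⟩ := MarkedPath.exists_path_eq hσ h₁ h₂ hlt
  exact ⟨_, ⟨(p, 0), mem_samplingAut_init.2 ⟨hp, rfl⟩, (r, 2),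
    mem_samplingAut_final.2 ⟨hr, .inr rfl⟩, MarkedPath.isPath_run hσ⟩,
    MarkedPath.describes_run fun s => hσ.mem, MarkedPath.samples_run hσ⟩

end Correspondence

end NotContains

/-! ### Mismatches between values of string terms -/

section Mismatch

variable {A X : Type*} {U V : List A} {σ τ : X → List A} {u v w : List X} {k p : ℕ} {a : A}

/-- `U`, shifted by `k` positions to the right, differs from `V` at a position of both. -/
def HasMismatch (U V : List A) (k : ℕ) : Prop :=
  ∃ (p : ℕ) (a b : A), U[p]? = some a ∧ V[k + p]? = some b ∧ a ≠ b

theorem not_isInfix_iff :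
    ¬ U <:+: V ↔ ∀ k, k + U.length ≤ V.length → HasMismatch U V k := by
  rw [List.infix_iff_getElem?]
  push Not
  refine forall_congr' fun k => ?_
  rw [Nat.add_comm k]
  refine imp_congr_right fun hk => ⟨?_, ?_⟩
  · rintro ⟨p, hp, hne⟩
    have hkp : k + p < V.length := by omega
    refine ⟨p, _, _, List.getElem?_eq_getElem hp, List.getElem?_eq_getElem hkp, fun h => hne ?_⟩
    rw [Nat.add_comm, List.getElem?_eq_getElem hkp, h]
  · rintro ⟨p, a, b, ha, hb, hab⟩
    obtain ⟨hp, rfl⟩ := List.getElem?_eq_some_iff.1 ha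
    refine ⟨p, hp, ?_⟩
    rw [Nat.add_comm, hb]
    exact fun h => hab (Option.some.inj h).symm

theorem termValue_nil : termValue σ [] = [] :=
  rfl

theorem termValue_cons (x : X) (w : List X) : termValue σ (x :: w) = σ x ++ termValue σ w :=
  rfl

theorem termValue_congr (h : ∀ x ∈ w, σ x = τ x) : termValue σ w = termValue τ w := by
  rw [termValue, termValue, List.map_congr_left h]

theorem getElem?_termValue_eq_some_iff : (termValue σ w)[p]? = some a ↔
    ∃ (i : Fin w.length) (o : ℕ),
      p = (termValue σ (w.take i)).length + o ∧ (σ (w.get i))[o]? = some a := by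
  induction w generalizing p with
  | nil => simp [termValue]
  | cons x w ih =>
    rw [termValue_cons]
    simp only [List.length_cons, Fin.exists_fin_succ, List.get_eq_getElem, Fin.val_zero,
      Fin.val_succ, List.take_zero, List.take_succ_cons, List.getElem_cons_zero,
      List.getElem_cons_succ, termValue_cons, List.length_append, termValue_nil, List.length_nil]
    rcases lt_or_ge p (σ x).length with hp | hp
    · rw [List.getElem?_append_left hp]
      constructor
      · exact fun h => .inl ⟨p, by omega, h⟩
      · rintro (⟨o, rfl, h⟩ | ⟨i, o, h, -⟩)
        · simpa using h
        · omega
    · rw [List.getElem?_append_right hp, ih]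
      constructor
      · rintro ⟨i, o, h, ha⟩
        exact .inr ⟨i, o, by omega, ha⟩
      · rintro (⟨o, rfl, h⟩ | ⟨i, o, h, ha⟩)
        · obtain ⟨ho, -⟩ := List.getElem?_eq_some_iff.1 h
          omega
        · exact ⟨i, o, by omega, ha⟩

/-- The position `o` of the occurrence of `x` as some `u[i]` and the position `o'` of the occurrence
of `y` as some `v[j]` coincide when the value of `u` is shifted by `k`. -/
def Aligned (σ : X → List A) (u v : List X) (k : ℕ) (x : X) (o : ℕ) (y : X) (o' : ℕ) : Prop :=
  ∃ (i : Fin u.length) (j : Fin v.length), u.get i = x ∧ v.get j = y ∧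
    k + ((termValue σ (u.take i)).length + o) = (termValue σ (v.take j)).length + o'

theorem hasMismatch_termValue_iff : HasMismatch (termValue σ u) (termValue σ v) k ↔
    ∃ x o a y o' b, Aligned σ u v k x o y o' ∧
      (σ x)[o]? = some a ∧ (σ y)[o']? = some b ∧ a ≠ b := by
  simp only [HasMismatch, getElem?_termValue_eq_some_iff]
  constructor
  · rintro ⟨_, a, b, ⟨i, o, rfl, ha⟩, ⟨j, o', h, hb⟩, hab⟩
    exact ⟨_, o, a, _, o', b, ⟨i, j, rfl, rfl, h⟩, ha, hb, hab⟩
  · rintro ⟨_, o, a, _, o', b, ⟨i, j, rfl, rfl, h⟩, ha, hb, hab⟩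
    exact ⟨_, a, b, ⟨i, o, rfl, ha⟩, ⟨j, o', h, hb⟩, hab⟩

end Mismatch

/-! ### Semantics of the formula -/

namespace NotContains

open LIATerm LIAFormula TransSystem TagAutomaton

section Semantics

variable {A X V : Type*} {Q : X → Type*}
  {ν : ParikhVar (Tag A X) ((Σ x, Q x) × Fin 3) → V} {α : V → ℤ} {ρ : List (CopyTrans A Q)}

/-- The values `f` of the Parikh variables are the numbers of occurrences of all tags in `ρ`. -/
def CountsTags (f : ParikhVar (Tag A X) ((Σ x, Q x) × Fin 3) → ℤ)
    (ρ : List (CopyTrans A Q)) : Prop :=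
  ∀ t, f (.tag t) = occ (fun δ => t ∈ δ.2.1) ρ

theorem eval_tagCount (hρ : CountsTags (α ∘ ν) ρ) (t : Tag A X) :
    (tagCount ν t).eval α = occ (fun δ => t ∈ δ.2.1) ρ :=
  hρ t

theorem eval_lenSum {R : ∀ x, List (Q x × A × Q x)} (hρ : CountsTags (α ∘ ν) ρ)
    (hR : Describes ρ R) (w : List X) :
    (lenSum ν w).eval α = (termValue (words R) w).length := by
  rw [lenSum]
  induction w with
  | nil => rfl
  | cons x w ih =>
    rw [termValue_cons, List.length_append, Nat.cast_add, ← ih, words, List.length_map, ← hR.len,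
      ← eval_tagCount hρ]
    rfl

theorem holds_sampledFormula [Fintype A] (hρ : CountsTags (α ∘ ν) ρ) {x y : X} :
    (sampledFormula ν x y).holds α ↔ (∃ a, 0 < occ (fun δ => Tag.mis₁ a x ∈ δ.2.1) ρ) ∧
      ∃ a, 0 < occ (fun δ => Tag.mis₂ a y ∈ δ.2.1) ρ := by
  simp only [sampledFormula, holds, holds_lt, eval, eval_sum_toList, eval_tagCount hρ,
    ← Nat.cast_sum, Nat.cast_pos, Finset.sum_pos_iff, Finset.mem_univ, true_and]

theorem holds_misFormula [Fintype A] [LinearOrder X] {κ : V} {u v : List X} :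
    (misFormula κ ν u v).holds α ↔
    ∃ (i : Fin u.length) (j : Fin v.length), (posFormula κ ν u v i j).holds α ∧
      (if u.get i ≤ v.get j then sampledFormula ν (u.get i) (v.get j)
        else sampledFormula ν (v.get j) (u.get i)).holds α := by
  simp only [misFormula, holds_disj, List.mem_flatMap, List.mem_map, List.mem_finRange, true_and]
  constructor
  · rintro ⟨_, ⟨i, j, rfl⟩, h⟩
    exact ⟨i, j, h⟩
  · rintro ⟨i, j, h⟩
    exact ⟨_, ⟨i, j, rfl⟩, h⟩

theorem not_holds_misFormula [Fintype A] [LinearOrder X] {κ : V} {u v : List X}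
    (hρ : CountsTags (α ∘ ν) ρ) (hmis : ∀ a x, occ (fun δ => Tag.mis₁ a x ∈ δ.2.1) ρ = 0) :
    ¬ (misFormula κ ν u v).holds α := by
  rw [holds_misFormula]
  rintro ⟨i, j, -, h⟩
  split_ifs at h <;> simp [holds_sampledFormula hρ, hmis] at h

variable {w : X → List A} {x₁ x₂ : X} {a₁ a₂ : A} {k₁ k₂ : ℕ}

theorem holds_symFormula_iff [Fintype A] [Fintype X] [Preorder X] (hρ : CountsTags (α ∘ ν) ρ)
    (hs : Samples ρ w x₁ a₁ k₁ x₂ a₂ k₂) : (symFormula ν).holds α ↔ a₁ ≠ a₂ := by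
  classical
  have hsum (a b : A) (y : X) :
      ∑ x, (((if a = b ∧ x = y then 1 else 0 : ℕ) : ℤ)) = if a = b then 1 else 0 := by
    by_cases h : a = b <;> simp [h]
  simp only [symFormula, holds_conj_toList, Finset.mem_univ, true_imp_iff, holds_lt,
    eval_sum_toList, eval, eval_tagCount hρ, hs.mis₁, hs.mis₂, Finset.sum_add_distrib, hsum]
  constructor
  · rintro h rfl
    simpa using h a₁
  · intro h a
    by_cases h₁ : a = a₁
    · rw [if_pos h₁, if_neg (h₁ ▸ h)]; norm_num
    · rw [if_neg h₁]; split_ifs <;> norm_num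

variable [LinearOrder X]

theorem holds_sampledFormula_iff [Fintype A] (hρ : CountsTags (α ∘ ν) ρ)
    (hs : Samples ρ w x₁ a₁ k₁ x₂ a₂ k₂) {x y : X} :
    (sampledFormula ν x y).holds α ↔ x = x₁ ∧ y = x₂ := by
  classical
  have hpos (P : Prop) [Decidable P] : 0 < (if P then 1 else 0) ↔ P := by
    split_ifs with h <;> simp [h]
  simp only [holds_sampledFormula hρ, hs.mis₁, hs.mis₂, hpos, exists_and_right, exists_eq,
    true_and]

variable {κ : V} {k : ℕ} {u v : List X} {R : ∀ x, List (Q x × A × Q x)}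

theorem holds_posFormula_and_iff [Fintype A] (hρ : CountsTags (α ∘ ν) ρ) (hR : Describes ρ R)
    (hs : Samples ρ w x₁ a₁ k₁ x₂ a₂ k₂) (hκ : α κ = k) (i : Fin u.length) (j : Fin v.length) :
    (posFormula κ ν u v i j).holds α ∧
      (if u.get i ≤ v.get j then sampledFormula ν (u.get i) (v.get j)
        else sampledFormula ν (v.get j) (u.get i)).holds α ↔
    (u.get i = x₁ ∧ v.get j = x₂ ∧ k + ((termValue (words R) (u.take i)).length + k₁) =
        (termValue (words R) (v.take j)).length + k₂) ∨
      (u.get i = x₂ ∧ v.get j = x₁ ∧ k + ((termValue (words R) (u.take i)).length + k₂) =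
        (termValue (words R) (v.take j)).length + k₁) := by
  have hpos₁ := hs.pos₁
  have hpos₂ := hs.pos₂
  have hzero := hs.pos₁_eq_zero
  have hle := hs.le
  unfold posFormula
  generalize u.get i = x, v.get j = y
  rcases lt_trichotomy x y with hxy | rfl | hxy
  · simp only [if_neg hxy.ne, if_pos hxy, if_pos hxy.le, holds, eval, eval_tagCount hρ,
      eval_lenSum hρ hR, holds_sampledFormula_iff hρ hs, hκ]
    grind
  · simp only [if_pos, le_refl, holds, eval, eval_tagCount hρ, eval_lenSum hρ hR,
      holds_sampledFormula_iff hρ hs, hκ]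
    grind
  · simp only [if_neg hxy.ne', if_neg hxy.not_gt, if_neg hxy.not_ge, holds, eval,
      eval_tagCount hρ, eval_lenSum hρ hR, holds_sampledFormula_iff hρ hs, hκ]
    grind

theorem holds_misFormula_iff [Fintype A] (hρ : CountsTags (α ∘ ν) ρ) (hR : Describes ρ R)
    (hs : Samples ρ w x₁ a₁ k₁ x₂ a₂ k₂) (hκ : α κ = k) :
    (misFormula κ ν u v).holds α ↔
      Aligned (words R) u v k x₁ k₁ x₂ k₂ ∨ Aligned (words R) u v k x₂ k₂ x₁ k₁ := by
  simp only [holds_misFormula, holds_posFormula_and_iff hρ hR hs hκ, exists_or, Aligned]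

end Semantics

section Correspondence

variable {A X V : Type*} [Fintype A] [Fintype X] [LinearOrder X] {Q : X → Type*}
  [∀ x, Fintype (Q x)] {aut : ∀ x, NFA A (Q x)}
  {f : ParikhVar (Tag A X) ((Σ x, Q x) × Fin 3) → ℤ}
  {ν ν' : ParikhVar (Tag A X) ((Σ x, Q x) × Fin 3) → V} {κ : V} {α : V → ℤ}
  {ρ ρ' : List (CopyTrans A Q)} {R R' : ∀ x, List (Q x × A × Q x)} {u v : List X} {k : ℕ}

/-- The values `f` of the Parikh variables encode the accepting runs `R x` of the automata by means
of the accepting run `ρ` of the sampling automaton. -/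
structure Encodes (aut : ∀ x, NFA A (Q x)) (f : ParikhVar (Tag A X) ((Σ x, Q x) × Fin 3) → ℤ)
    (ρ : List (CopyTrans A Q)) (R : ∀ x, List (Q x × A × Q x)) : Prop where
  isAcceptingRun : ∀ x, (ofNFA (aut x)).IsAcceptingRun (R x)
  run : (samplingAut aut).toTransSystem.IsAcceptingRun ρ
  describes : Describes ρ R
  counts : (samplingAut aut).CountsRun f ρ

namespace Encodes

theorem mem_trans (h : Encodes aut f ρ R) : ∀ δ ∈ ρ, δ ∈ (samplingAut aut).trans :=
  have ⟨_, _, _, _, hρ⟩ := h.run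
  fun _ => hρ.mem

theorem countsTags [Nonempty X] (h : Encodes aut f ρ R) : CountsTags f ρ :=
  fun t => h.counts.tag t (mem_samplingAut_tags t)

theorem eval_lenSum [Nonempty X] (h : Encodes aut (α ∘ ν) ρ R) (w : List X) :
    (lenSum ν w).eval α = (termValue (words R) w).length :=
  NotContains.eval_lenSum h.countsTags h.describes w

open scoped Classical in
theorem eval_transSum_isCopyOf (h : Encodes aut (α ∘ ν) ρ R) (x : X) (t : Q x × A × Q x) :
    ((samplingAut aut).transSum ν (IsCopyOf x t)).eval α = occ (fun t' => t' = t) (R x) := by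
  rw [h.counts.eval_transSum h.mem_trans, h.describes.copy]

end Encodes

theorem exists_encodes (h : (samplingAut aut).IsParikhModel f) :
    ∃ ρ R, Encodes aut f ρ R ∧ ((∀ a x, occ (fun δ => Tag.mis₁ a x ∈ δ.2.1) ρ = 0) ∨
      ∃ x₁ a₁ k₁ x₂ a₂ k₂, Samples ρ (words R) x₁ a₁ k₁ x₂ a₂ k₂) := by
  obtain ⟨ρ, hρ, hf⟩ := h.exists_isAcceptingRun
  obtain ⟨R, hR, hρR, hmis⟩ := exists_describes hρ
  exact ⟨ρ, R, ⟨hR, hρ, hρR, hf⟩, hmis⟩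

open scoped Classical in
theorem holds_equalWordFormula_iff (h : Encodes aut (α ∘ ν) ρ R)
    (h' : Encodes aut (α ∘ ν') ρ' R') : (equalWordFormula (concatAut aut) ν ν').holds α ↔
      ∀ x t, occ (fun t' => t' = t) (R x) = occ (fun t' => t' = t) (R' x) := by
  have hcopy (x t) : (LIAFormula.eq ((samplingAut aut).transSum ν (IsCopyOf x t))
      ((samplingAut aut).transSum ν' (IsCopyOf x t))).holds α ↔
        occ (fun t' => t' = t) (R x) = occ (fun t' => t' = t) (R' x) := by
    rw [holds, h.eval_transSum_isCopyOf, h'.eval_transSum_isCopyOf, Nat.cast_inj]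
  have hzero {R : ∀ x, List (Q x × A × Q x)} (hR : ∀ x, (ofNFA (aut x)).IsAcceptingRun (R x))
      {x t} (ht : t ∉ (ofNFA (aut x)).trans) : occ (fun t' => t' = t) (R x) = 0 := by
    obtain ⟨_, _, _, _, hpath⟩ := hR x
    rw [occ_eq_zero]
    rintro _ ht' rfl
    exact ht (hpath.mem ht')
  simp only [equalWordFormula, holds_conj, List.mem_flatMap, List.mem_map, Finset.mem_toList,
    Finset.mem_univ, true_and, mem_letterTrans]
  constructor
  · intro hall x t
    by_cases ht : t ∈ (ofNFA (aut x)).trans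
    · exact (hcopy x t).1 (hall _ ⟨(t.2.1, x), _, ⟨t, ht, rfl, rfl⟩, rfl⟩)
    · rw [hzero h.isAcceptingRun ht, hzero h'.isAcceptingRun ht]
  · rintro hall _ ⟨⟨a, x⟩, _, ht, rfl⟩
    dsimp only at ht
    obtain ⟨t, -, rfl, rfl⟩ := ht
    exact (hcopy x t).2 (hall x t)

/-- The subformula for the second run: `ν'` describes a run that samples two mismatching positions
for the offset `κ` and reads the same words as the run described by `ν`. -/
noncomputable def mismatchFormula (aut : ∀ x, NFA A (Q x)) (κ : V)
    (ν ν' : ParikhVar (Tag A X) ((Σ x, Q x) × Fin 3) → V) (u v : List X) : LIAFormula V :=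
  and ((samplingAut aut).parikhTagFormula ν')
    (and (equalWordFormula (concatAut aut) ν ν') (and (symFormula ν') (misFormula κ ν' u v)))

theorem hasMismatch_of_holds_mismatchFormula [Nonempty X]
    (hflat : ∀ x, x ∈ u ∨ x ∈ v → (aut x).IsFlat) (h : Encodes aut (α ∘ ν) ρ R) (hκ : α κ = k)
    (hα : (mismatchFormula aut κ ν ν' u v).holds α) :
    HasMismatch (termValue (words R) u) (termValue (words R) v) k := by
  obtain ⟨hparikh, heq, hsym, hmis⟩ := hα
  obtain ⟨ρ', R', h', hnone | ⟨x₁, a₁, k₁, x₂, a₂, k₂, hs⟩⟩ :=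
    exists_encodes (holds_parikhTagFormula.1 hparikh)
  · exact absurd hmis (not_holds_misFormula h'.countsTags hnone)
  rw [holds_equalWordFormula_iff h h'] at heq
  rw [holds_symFormula_iff h'.countsTags hs] at hsym
  rw [holds_misFormula_iff h'.countsTags h'.describes hs hκ] at hmis
  -- By flatness, the second run reads the same words as the first one.
  have hwords (x) (hx : x ∈ u ∨ x ∈ v) : words R x = words R' x := by
    rw [words, words,
      (h.isAcceptingRun x).eq_of_isFlat (h'.isAcceptingRun x) (hflat x hx) (heq x)]
  rw [termValue_congr fun x hx => hwords x (.inl hx),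
    termValue_congr fun x hx => hwords x (.inr hx), hasMismatch_termValue_iff]
  rcases hmis with hmis | hmis
  · exact ⟨_, _, _, _, _, _, hmis, hs.letter₁, hs.letter₂, hsym⟩
  · exact ⟨_, _, _, _, _, _, hmis, hs.letter₂, hs.letter₁, hsym.symm⟩

theorem exists_samples_of_hasMismatch [Nonempty X]
    (hR : ∀ x, (ofNFA (aut x)).IsAcceptingRun (R x))
    (hmis : HasMismatch (termValue (words R) u) (termValue (words R) v) k) :
    ∃ ρ x₁ a₁ k₁ x₂ a₂ k₂, (samplingAut aut).toTransSystem.IsAcceptingRun ρ ∧ Describes ρ R ∧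
      Samples ρ (words R) x₁ a₁ k₁ x₂ a₂ k₂ ∧ a₁ ≠ a₂ ∧
        (Aligned (words R) u v k x₁ k₁ x₂ k₂ ∨ Aligned (words R) u v k x₂ k₂ x₁ k₁) := by
  obtain ⟨x, o, a, y, o', b, halign, hx, hy, hab⟩ := hasMismatch_termValue_iff.1 hmis
  have hlt : (x < y ∨ x = y ∧ o < o') ∨ (y < x ∨ y = x ∧ o' < o) := by
    rcases lt_trichotomy x y with hxy | rfl | hxy
    · exact .inl (.inl hxy)
    · have ho : o ≠ o' := by
        rintro rfl
        exact hab (Option.some.inj (hx.symm.trans hy))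
      exact ho.lt_or_gt.imp (fun h => .inr ⟨rfl, h⟩) fun h => .inr ⟨rfl, h⟩
    · exact .inr (.inl hxy)
  rcases hlt with hlt | hlt
  · obtain ⟨ρ, hρ, hρR, hs⟩ := exists_isAcceptingRun_samples hR hx hy hlt
    exact ⟨ρ, _, _, _, _, _, _, hρ, hρR, hs, hab, .inl halign⟩
  · obtain ⟨ρ, hρ, hρR, hs⟩ := exists_isAcceptingRun_samples hR hy hx hlt
    exact ⟨ρ, _, _, _, _, _, _, hρ, hρR, hs, hab.symm, .inr halign⟩

theorem exists_holds_mismatchFormula [Nonempty X]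
    (hR : ∀ x, (ofNFA (aut x)).IsAcceptingRun (R x))
    (hmis : HasMismatch (termValue (words R) u) (termValue (words R) v) k) :
    ∃ g : ParikhVar (Tag A X) ((Σ x, Q x) × Fin 3) → ℤ,
      ∀ {V : Type _} {κ : V} {ν ν' : ParikhVar (Tag A X) ((Σ x, Q x) × Fin 3) → V} {α : V → ℤ}
        {ρ : List (CopyTrans A Q)}, Encodes aut (α ∘ ν) ρ R → α κ = k →
        (∀ z ∈ (samplingAut aut).parikhVars, α (ν' z) = g z) →
        (mismatchFormula aut κ ν ν' u v).holds α := by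
  obtain ⟨ρ', x₁, a₁, k₁, x₂, a₂, k₂, hρ', hρR', hs, hne, halign⟩ :=
    exists_samples_of_hasMismatch hR hmis
  obtain ⟨g, hg, hgρ'⟩ := exists_isParikhModel hρ'
  refine ⟨g, fun {V κ ν ν' α ρ} h hκ hα => ?_⟩
  have h' : Encodes aut (α ∘ ν') ρ' R := ⟨hR, hρ', hρR', hgρ'.congr hα⟩
  exact ⟨holds_parikhTagFormula.2 (hg.congr hα),
    (holds_equalWordFormula_iff h h').2 fun _ _ => rfl,
    (holds_symFormula_iff h'.countsTags hs).2 hne,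
    (holds_misFormula_iff h'.countsTags hρR' hs hκ).2 halign⟩

end Correspondence

section Correctness

variable {A X I : Type*} [Fintype A] [Fintype X] [LinearOrder X] {Q : X → Type*}
  [∀ x, Fintype (Q x)] {aut : ∀ x, NFA A (Q x)} {u v : List X}
  {ints : List (LIATerm I × LIATerm I)} {R : ∀ x, List (Q x × A × Q x)}
  {ρ : List (CopyTrans A Q)} {α : Var I (Tag A X) ((Σ x, Q x) × Fin 3) → ℤ} {k : ℕ}

theorem holds_intFormula {T S : Type*} {α : Var I T S → ℤ} : (intFormula ints).holds α ↔
    ∀ c ∈ ints, c.1.eval (α ∘ Var.int) ≤ c.2.eval (α ∘ Var.int) := by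
  simp only [intFormula, holds_conj, List.mem_map, forall_exists_index, and_imp,
    forall_apply_eq_imp_iff₂, holds, eval_rename]

open scoped Classical in
theorem holds_ex_mismatchFormula_iff [Nonempty X]
    (hflat : ∀ x, x ∈ u ∨ x ∈ v → (aut x).IsFlat) (h : Encodes aut (α ∘ .fst) ρ R)
    (hk : α .offset = k) :
    (ex ((samplingAut aut).parikhVars.image .snd)
      (mismatchFormula aut .offset .fst .snd u v)).holds α ↔
        HasMismatch (termValue (words R) u) (termValue (words R) v) k := by
  constructor
  · rintro ⟨γ, hγ, hmis⟩
    have hfst : γ ∘ .fst = α ∘ .fst := funext fun z => hγ _ (by simp)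
    exact hasMismatch_of_holds_mismatchFormula hflat (hfst ▸ h)
      ((hγ _ (by simp)).trans hk) hmis
  · intro hmis
    obtain ⟨g, hg⟩ := exists_holds_mismatchFormula h.isAcceptingRun hmis
    let γ : Var I (Tag A X) ((Σ x, Q x) × Fin 3) → ℤ
      | .snd z => if z ∈ (samplingAut aut).parikhVars then g z else α (.snd z)
      | x => α x
    refine ⟨γ, ?_, hg (α := γ) h hk fun z hz => if_pos hz⟩
    rintro (i | z | z | _) hz
    · rfl
    · rfl
    · exact if_neg fun hz' => hz (Finset.mem_image_of_mem _ hz')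
    · rfl

theorem holds_offset_notMem_range_iff [Nonempty X] (h : Encodes aut (α ∘ .fst) ρ R) :
    (or (lt (var .offset) (const 0)) (lt (lenDiff .fst u v) (var .offset))).holds α ↔
      ¬ ∃ k : ℕ, α .offset = k ∧
        k + (termValue (words R) u).length ≤ (termValue (words R) v).length := by
  simp only [holds, holds_lt, lenDiff, eval, h.eval_lenSum]
  constructor
  · rintro hα ⟨k, hk, hle⟩
    omega
  · intro hα
    by_contra! hrange
    exact hα ⟨(α .offset).toNat, by omega, by omega⟩

theorem holds_formula_iff [Nonempty X] (hflat : ∀ x, x ∈ u ∨ x ∈ v → (aut x).IsFlat)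
    (h : Encodes aut (α ∘ .fst) ρ R) : (formula I aut u v).holds α ↔
      (samplingAut aut).IsParikhModel (α ∘ .fst) ∧
        ¬ termValue (words R) u <:+: termValue (words R) v := by
  classical
  rw [not_isInfix_iff, ← holds_parikhTagFormula]
  refine and_congr_right fun _ => ⟨fun hα k hk => ?_, fun hmis β hβ => ?_⟩
  · let β : Var I (Tag A X) ((Σ x, Q x) × Fin 3) → ℤ
      | .offset => k
      | z => α z
    have hβα : ∀ z, z ∉ ({.offset} : Finset (Var I (Tag A X) ((Σ x, Q x) × Fin 3))) →
        β z = α z := by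
      rintro (i | z | z | _) hz <;> first | rfl | exact absurd (Finset.mem_singleton_self _) hz
    obtain ⟨γ, hγ, hmis | hrange⟩ := hα β hβα
    · exact (holds_ex_mismatchFormula_iff (α := β) hflat h rfl).1 ⟨γ, hγ, hmis⟩
    · have hfst : γ ∘ .fst = α ∘ .fst := funext fun z => hγ _ (by simp)
      exact absurd ⟨k, hγ _ (by simp), hk⟩
        ((holds_offset_notMem_range_iff (hfst ▸ h)).1 hrange)
  · have hfst : β ∘ .fst = α ∘ .fst := funext fun z => hβ _ (by simp)
    by_cases hrange : ∃ k : ℕ, β .offset = k ∧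
        k + (termValue (words R) u).length ≤ (termValue (words R) v).length
    · obtain ⟨k, hk, hle⟩ := hrange
      obtain ⟨γ, hγ, hγmis⟩ :=
        (holds_ex_mismatchFormula_iff hflat (hfst ▸ h) hk).2 (hmis k hle)
      exact ⟨γ, hγ, .inl hγmis⟩
    · exact ⟨β, fun _ _ => rfl, .inr ((holds_offset_notMem_range_iff (hfst ▸ h)).2 hrange)⟩

theorem satisfiable_and_formula_iff (hu : u ≠ [])
    (hflat : ∀ x, x ∈ u ∨ x ∈ v → (aut x).IsFlat) :
    (LIAFormula.and (intFormula ints) (formula I aut u v)).Satisfiable ↔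
      NotContainsSatisfiable aut ints u v := by
  have : Nonempty X := ⟨u.head hu⟩
  constructor
  · rintro ⟨α, hint, hα⟩
    obtain ⟨ρ, R, h, -⟩ := exists_encodes (holds_parikhTagFormula.1 hα.1)
    exact ⟨words R, α ∘ .int, fun x => mem_accepts_iff.2 ⟨R x, h.isAcceptingRun x, rfl⟩,
      holds_intFormula.1 hint, ((holds_formula_iff hflat h).1 hα).2⟩
  · rintro ⟨σ, η, hσ, hη, hnot⟩
    choose R hR hRσ using fun x => mem_accepts_iff.1 (hσ x)
    obtain rfl : words R = σ := funext hRσ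
    obtain ⟨ρ, hρ, hρR⟩ := exists_isAcceptingRun_describes hR
    obtain ⟨f, hf, hfρ⟩ := exists_isParikhModel hρ
    let α : Var I (Tag A X) ((Σ x, Q x) × Fin 3) → ℤ
      | .int i => η i
      | .fst z => f z
      | _ => 0
    exact ⟨α, holds_intFormula.2 hη,
      (holds_formula_iff (α := α) hflat ⟨hR, hρ, hρR, hfρ⟩).2 ⟨hf, hnot⟩⟩

end Correctness

end NotContains

/-! ### The size of the formula -/

namespace LIATerm

variable {V : Type*}

theorem size_sum_le {l : List (LIATerm V)} {c k : ℕ} (h : ∀ t ∈ l, t.size ≤ c)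
    (hk : l.length ≤ k) : (LIATerm.sum l).size ≤ k * (c + 1) + 1 := by
  grw [← hk]
  clear hk
  induction l with
  | nil => simp [sum, size]
  | cons t l ih =>
    obtain ⟨h₁, h₂⟩ := List.forall_mem_cons.1 h
    have := ih h₂
    rw [List.length_cons, add_mul, one_mul]
    simp only [sum, List.foldr_cons, size] at this ⊢
    omega

theorem size_sum_toList_map_le {E : Type*} {s : Finset E} {g : E → LIATerm V} {c k : ℕ}
    (h : ∀ e ∈ s, (g e).size ≤ c) (hk : s.card ≤ k) :
    (LIATerm.sum (s.toList.map g)).size ≤ k * (c + 1) + 1 :=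
  size_sum_le (by simpa using h) (by simpa using hk)

end LIATerm

namespace LIAFormula

variable {V : Type*}

theorem size_conj_le {l : List (LIAFormula V)} {c k : ℕ} (h : ∀ φ ∈ l, φ.size ≤ c)
    (hk : l.length ≤ k) : (conj l).size ≤ k * (c + 1) + 3 := by
  grw [← hk]
  clear hk
  induction l with
  | nil => simp [conj, size, LIATerm.size]
  | cons t l ih =>
    obtain ⟨h₁, h₂⟩ := List.forall_mem_cons.1 h
    have := ih h₂
    rw [List.length_cons, add_mul, one_mul]
    simp only [conj, List.foldr_cons, size] at this ⊢
    omega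

theorem size_conj_toList_map_le {E : Type*} {s : Finset E} {g : E → LIAFormula V} {c k : ℕ}
    (h : ∀ e ∈ s, (g e).size ≤ c) (hk : s.card ≤ k) :
    (conj (s.toList.map g)).size ≤ k * (c + 1) + 3 :=
  size_conj_le (by simpa using h) (by simpa using hk)

theorem size_disj_le {l : List (LIAFormula V)} {c k : ℕ} (h : ∀ φ ∈ l, φ.size ≤ c)
    (hk : l.length ≤ k) : (disj l).size ≤ k * (c + 1) + 4 := by
  grw [← hk]
  clear hk
  induction l with
  | nil => simp [disj, size, LIATerm.size]
  | cons t l ih =>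
    obtain ⟨h₁, h₂⟩ := List.forall_mem_cons.1 h
    have := ih h₂
    rw [List.length_cons, add_mul, one_mul]
    simp only [disj, List.foldr_cons, size] at this ⊢
    omega

theorem size_disj_toList_map_le {E : Type*} {s : Finset E} {g : E → LIAFormula V} {c k : ℕ}
    (h : ∀ e ∈ s, (g e).size ≤ c) (hk : s.card ≤ k) :
    (disj (s.toList.map g)).size ≤ k * (c + 1) + 4 :=
  size_disj_le (by simpa using h) (by simpa using hk)

end LIAFormula

namespace TagAutomaton

open LIATerm LIAFormula

variable {T S V : Type*} {B : TagAutomaton T S} {ν : ParikhVar T S → V} {M : ℕ}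

theorem size_transSum_le (ht : B.trans.card ≤ M) (P : S × Finset T × S → Prop) :
    (B.transSum ν P).size ≤ 2 * M + 1 := by
  classical
  have := size_sum_toList_map_le (s := B.trans.filter P) (g := fun δ => var (ν (.trans δ)))
    (fun _ _ => le_of_eq (by rw [LIATerm.size])) ((Finset.card_filter_le _ _).trans ht)
  rw [transSum]
  omega

theorem size_kirchhoffFormula_le (ht : B.trans.card ≤ M) (q : S) :
    (B.kirchhoffFormula ν q).size ≤ 4 * M + 7 := by
  have h₁ := size_transSum_le (ν := ν) ht fun δ => δ.2.2 = q
  have h₂ := size_transSum_le (ν := ν) ht fun δ => δ.1 = q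
  simp only [kirchhoffFormula, LIAFormula.size, LIATerm.size]
  omega

theorem size_spanFormula_le (ht : B.trans.card ≤ M) (q : S) :
    (B.spanFormula ν q).size ≤ 22 * M + 46 := by
  classical
  have hinto : (B.trans.filter fun δ => δ.2.2 = q).card ≤ M := (Finset.card_filter_le _ _).trans ht
  have hconj := size_conj_toList_map_le (c := 3)
    (g := fun δ => eq (var (ν (.trans δ))) (const 0))
    (fun _ _ => by simp [LIAFormula.size, LIATerm.size]) hinto
  have hdisj := size_disj_toList_map_le (c := 17)
    (g := fun δ => and (lt (const 0) (var (ν (.trans δ))))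
      (and (le (const 0) (var (ν (.span δ.1))))
        (eq (var (ν (.span q))) (add (var (ν (.span δ.1))) (const 1)))))
    (fun _ _ => by simp [lt, LIAFormula.size, LIATerm.size]) hinto
  simp only [spanFormula, iff, imp, lt, LIAFormula.size, LIATerm.size, Int.natAbs_zero,
    Int.natAbs_one, Int.natAbs_neg, Nat.size_zero, Nat.size_one] at hconj hdisj ⊢
  omega

variable [Fintype S]

theorem size_initFormula_le (hS : Fintype.card S ≤ M) :
    (B.initFormula ν).size ≤ 15 * M + 12 := by
  classical
  have hcard (s : Finset S) : s.card ≤ M := (Finset.card_le_univ s).trans hS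
  have hrange := size_conj_toList_map_le (c := 8) (s := B.init)
    (g := fun q => and (le (const 0) (var (ν (.init q)))) (le (var (ν (.init q))) (const 1)))
    (fun _ _ => by simp [LIAFormula.size, LIATerm.size]) (hcard _)
  have hzero := size_conj_toList_map_le (c := 3) (s := Finset.univ \ B.init)
    (g := fun q => eq (var (ν (.init q))) (const 0))
    (fun _ _ => by simp [LIAFormula.size, LIATerm.size]) (hcard _)
  have hsum := size_sum_toList_map_le (c := 1) (s := B.init)
    (g := fun q => var (ν (.init q))) (fun _ _ => by simp [LIATerm.size]) (hcard _)
  simp only [initFormula, LIAFormula.size, LIATerm.size, Int.natAbs_one, Nat.size_one]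
    at hrange hzero hsum ⊢
  omega

theorem size_finalFormula_le (hS : Fintype.card S ≤ M) :
    (B.finalFormula ν).size ≤ 13 * M + 7 := by
  classical
  have hcard (s : Finset S) : s.card ≤ M := (Finset.card_le_univ s).trans hS
  have hrange := size_conj_toList_map_le (c := 8) (s := B.final)
    (g := fun q => and (le (const 0) (var (ν (.final q)))) (le (var (ν (.final q))) (const 1)))
    (fun _ _ => by simp [LIAFormula.size, LIATerm.size]) (hcard _)
  have hzero := size_conj_toList_map_le (c := 3) (s := Finset.univ \ B.final)
    (g := fun q => eq (var (ν (.final q))) (const 0))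
    (fun _ _ => by simp [LIAFormula.size, LIATerm.size]) (hcard _)
  simp only [finalFormula, LIAFormula.size] at hrange hzero ⊢
  omega

theorem size_parikhFormula_le (hS : Fintype.card S ≤ M) (ht : B.trans.card ≤ M) :
    (B.parikhFormula ν).size ≤ 26 * M ^ 2 + 87 * M + 28 := by
  have hinit := size_initFormula_le (B := B) (ν := ν) hS
  have hfinal := size_finalFormula_le (B := B) (ν := ν) hS
  have hstate (q : S) :
      (and (B.kirchhoffFormula ν q) (B.spanFormula ν q)).size ≤ 26 * M + 54 := by
    have := size_kirchhoffFormula_le (ν := ν) ht q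
    have := size_spanFormula_le (ν := ν) ht q
    rw [LIAFormula.size]
    omega
  have hstates := size_conj_toList_map_le (s := Finset.univ) (fun q _ => hstate q) hS
  have hnonneg := size_conj_toList_map_le (c := 3)
    (g := fun δ => le (const 0) (var (ν (.trans δ))))
    (fun _ _ => by simp [LIAFormula.size, LIATerm.size]) ht
  simp only [parikhFormula, LIAFormula.size]
  linarith

theorem size_parikhTagFormula_le (hM : 1 ≤ M) (hS : Fintype.card S ≤ M)
    (ht : B.trans.card ≤ M) (hg : B.tags.card ≤ M) :
    (B.parikhTagFormula ν).size ≤ 160 * M ^ 2 := by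
  classical
  have hparikh := size_parikhFormula_le (ν := ν) hS ht
  have htag (t : T) :
      (eq (var (ν (.tag t))) (B.transSum ν fun δ => t ∈ δ.2.1)).size ≤ 2 * M + 3 := by
    have := size_transSum_le (ν := ν) ht fun δ => t ∈ δ.2.1
    simp only [LIAFormula.size, LIATerm.size]
    omega
  have htags := size_conj_toList_map_le (fun t _ => htag t) hg
  simp only [parikhTagFormula, LIAFormula.size]
  nlinarith

theorem card_parikhVars_le (hS : Fintype.card S ≤ M) (ht : B.trans.card ≤ M)
    (hg : B.tags.card ≤ M) : B.parikhVars.card ≤ 5 * M := by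
  classical
  have hstates (f : S → ParikhVar T S) : (Finset.univ.image f).card ≤ M :=
    Finset.card_image_le.trans hS
  rw [parikhVars]
  grw [Finset.card_union_le, Finset.card_union_le, Finset.card_union_le, Finset.card_union_le,
    hstates, hstates, hstates, Finset.card_image_le, Finset.card_image_le, ht, hg]
  omega

end TagAutomaton

namespace NotContains

open LIATerm LIAFormula TagAutomaton

section SubformulaSize

variable {A X V S : Type*} {ν : ParikhVar (Tag A X) S → V} {κ : V} {u v w : List X} {M : ℕ}

theorem size_lenSum_le (hw : w.length ≤ M) : (lenSum ν w).size ≤ 2 * M + 1 := by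
  have := size_sum_le (c := 1) (k := M) (l := w.map fun x => tagCount ν (.len x))
    (by simp [tagCount, LIATerm.size]) (by rwa [List.length_map])
  rw [lenSum]
  omega

theorem size_posFormula_le [LinearOrder X] (hu : u.length ≤ M) (hv : v.length ≤ M)
    (i : Fin u.length) (j : Fin v.length) : (posFormula κ ν u v i j).size ≤ 8 * M + 31 := by
  have h₁ : (lenSum ν (u.take i)).size ≤ 2 * M + 1 :=
    size_lenSum_le ((List.length_take_le _ _).trans (i.2.le.trans hu))
  have h₂ : (lenSum ν (v.take j)).size ≤ 2 * M + 1 :=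
    size_lenSum_le ((List.length_take_le _ _).trans (j.2.le.trans hv))
  simp only [posFormula]
  split_ifs <;> simp only [tagCount, LIAFormula.size, LIATerm.size] <;> omega

variable [Fintype A]

theorem size_sampledFormula_le (hA : Fintype.card A ≤ M) (x y : X) :
    (sampledFormula ν x y).size ≤ 4 * M + 13 := by
  have hcount (f : A → Tag A X) := size_sum_toList_map_le (c := 1) (s := Finset.univ)
    (g := fun a => tagCount ν (f a)) (fun _ _ => by simp [tagCount, LIATerm.size]) hA
  have h₁ := hcount fun a => .mis₁ a x
  have h₂ := hcount fun a => .mis₂ a y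
  simp only [sampledFormula, lt, LIAFormula.size, LIATerm.size, Int.natAbs_one, Nat.size_one,
    Int.natAbs_zero, Nat.size_zero]
  omega

theorem size_misFormula_le [LinearOrder X] (hA : Fintype.card A ≤ M) (hu : u.length ≤ M)
    (hv : v.length ≤ M) : (misFormula κ ν u v).size ≤ M * M * (12 * M + 46) + 4 := by
  refine size_disj_le ?_ ?_
  · simp only [List.mem_flatMap, List.mem_map, List.mem_finRange, true_and]
    rintro _ ⟨i, j, rfl⟩
    have hpos := size_posFormula_le (κ := κ) (ν := ν) hu hv i j
    have hsampled (x y : X) := size_sampledFormula_le (ν := ν) hA x y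
    rw [LIAFormula.size]
    grw [hpos]
    split_ifs <;> grw [hsampled] <;> omega
  · simpa using Nat.mul_le_mul hu hv

theorem size_symFormula_le [Fintype X] (hA : Fintype.card A ≤ M) (hX : Fintype.card X ≤ M) :
    (symFormula ν).size ≤ M * (4 * M + 9) + 3 := by
  refine size_conj_toList_map_le (fun a _ => ?_) hA
  have := size_sum_toList_map_le (c := 3) (s := Finset.univ)
    (g := fun x => add (tagCount ν (.mis₁ a x)) (tagCount ν (.mis₂ a x)))
    (fun _ _ => by simp [tagCount, LIATerm.size]) hX
  have hsize : Nat.size (Int.natAbs 2) = 2 := Nat.size_pow (n := 1)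
  simp only [lt, LIAFormula.size, LIATerm.size, Int.natAbs_one, Nat.size_one, hsize]
  omega

theorem size_equalWordFormula_le [Fintype X] {C : TagAutomaton (Tag A X) S}
    {ν₁ ν₂ : ParikhVar (Tag A X) (S × Fin 3) → V} (hAX : Fintype.card (A × X) ≤ M)
    (ht : (threeCopies C).trans.card ≤ M) (hC : C.trans.card ≤ M) :
    (equalWordFormula C ν₁ ν₂).size ≤ M * M * (4 * M + 4) + 3 := by
  classical
  refine size_conj_le ?_ ?_
  · simp only [List.mem_flatMap, List.mem_map]
    rintro _ ⟨p, _, t, _, rfl⟩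
    rw [LIAFormula.size]
    grw [size_transSum_le ht, size_transSum_le ht]
    omega
  · rw [List.length_flatMap]
    refine (List.sum_le_card_nsmul _ M ?_).trans ?_
    · simp only [List.forall_mem_map, List.length_map, Finset.length_toList]
      exact fun p _ => (Finset.card_filter_le _ _).trans hC
    · rw [List.length_map, Finset.length_toList, smul_eq_mul]
      exact Nat.mul_le_mul_right _ hAX

end SubformulaSize

section FormulaSize

variable {A X : Type*} [Fintype A] [Fintype X]

theorem card_threeCopies_trans_le {S : Type*} (C : TagAutomaton (Tag A X) S) :
    (threeCopies C).trans.card ≤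
      Fintype.card (A × X) * (C.trans.card * 5) + C.trans.card * 3 := by
  classical
  refine (Finset.card_union_le _ _).trans (Nat.add_le_add ?_ ?_)
  · refine Finset.card_biUnion_le_card_mul _ _ _ fun p _ => ?_
    refine (Finset.card_biUnion_le_card_mul _ _ 5 fun t _ => Finset.card_le_five).trans ?_
    exact Nat.mul_le_mul_right _ (Finset.card_filter_le _ _)
  · refine (Finset.card_biUnion_le_card_mul _ _ 3 fun t _ => Finset.card_image_le).trans ?_
    exact Nat.mul_le_mul_right _ (Finset.card_filter_le _ _)

theorem card_threeCopies_tags_le {S : Type*} (C : TagAutomaton (Tag A X) S) :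
    (threeCopies C).tags.card ≤
      C.tags.card + 2 * Fintype.card (A × X) + 3 * Fintype.card X := by
  classical
  rw [threeCopies]
  grw [Finset.card_union_le, Finset.card_union_le, Finset.card_union_le, Finset.card_union_le,
    Finset.card_union_le, Finset.card_image_le, Finset.card_image_le, Finset.card_image_le,
    Finset.card_image_le, Finset.card_image_le, Finset.card_univ, Finset.card_univ]
  omega

variable [LinearOrder X] {Q : X → Type*} [∀ x, Fintype (Q x)] {aut : ∀ x, NFA A (Q x)}

theorem card_concatAut_trans_le : (concatAut aut).trans.card ≤
    Fintype.card X * (Fintype.card (Σ x, Q x) * (Fintype.card A * Fintype.card (Σ x, Q x))) +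
      Fintype.card (Σ x, Q x) * Fintype.card (Σ x, Q x) := by
  classical
  refine (Finset.card_union_le _ _).trans (Nat.add_le_add ?_ ?_)
  · refine Finset.card_biUnion_le_card_mul _ _ _ fun x _ => Finset.card_image_le.trans ?_
    refine Finset.card_image_le.trans ((Finset.card_filter_le _ _).trans ?_)
    have hx : Fintype.card (Q x) ≤ Fintype.card (Σ x, Q x) :=
      Fintype.card_le_of_injective _ sigma_mk_injective
    rw [Finset.card_univ, Fintype.card_prod, Fintype.card_prod]
    gcongr
  · refine Finset.card_image_le.trans ((Finset.card_filter_le _ _).trans ?_)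
    rw [Finset.card_univ, Fintype.card_prod]

theorem card_concatAut_tags_le :
    (concatAut aut).tags.card ≤ Fintype.card X * (Fintype.card A + 1) := by
  classical
  refine Finset.card_biUnion_le_card_mul _ _ _ fun x _ => (Finset.card_union_le _ _).trans ?_
  exact Nat.add_le_add_right Finset.card_image_le 1

variable {u v : List X}

theorem size_mismatchFormula_le {V : Type*} {κ : V}
    {ν ν' : ParikhVar (Tag A X) ((Σ x, Q x) × Fin 3) → V} {M : ℕ} (hM : 1 ≤ M)
    (hu : u.length ≤ M) (hv : v.length ≤ M) (hA : Fintype.card A ≤ M) (hX : Fintype.card X ≤ M)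
    (hAX : Fintype.card (A × X) ≤ M) (hS : Fintype.card ((Σ x, Q x) × Fin 3) ≤ M)
    (hC : (concatAut aut).trans.card ≤ M) (ht : (samplingAut aut).trans.card ≤ M)
    (hg : (samplingAut aut).tags.card ≤ M) :
    (mismatchFormula aut κ ν ν' u v).size ≤ 16 * M ^ 3 + 214 * M ^ 2 + 9 * M + 13 := by
  simp only [mismatchFormula, LIAFormula.size]
  grw [size_parikhTagFormula_le hM hS ht hg, size_equalWordFormula_le hAX ht hC,
    size_symFormula_le hA hX, size_misFormula_le hA hu hv]
  linarith

variable (I : Type*)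

theorem size_formula_le_of_card_samplingAut_le {M : ℕ} (hM : 1 ≤ M) (hu : u.length ≤ M)
    (hv : v.length ≤ M) (hA : Fintype.card A ≤ M) (hX : Fintype.card X ≤ M)
    (hAX : Fintype.card (A × X) ≤ M) (hS : Fintype.card ((Σ x, Q x) × Fin 3) ≤ M)
    (hC : (concatAut aut).trans.card ≤ M) (ht : (samplingAut aut).trans.card ≤ M)
    (hg : (samplingAut aut).tags.card ≤ M) : (formula I aut u v).size ≤ 500 * M ^ 3 := by
  classical
  change (and ((samplingAut aut).parikhTagFormula .fst) (all {Var.offset}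
    (ex ((samplingAut aut).parikhVars.image .snd)
      (or (mismatchFormula aut .offset .fst .snd u v)
        (or (lt (var .offset) (const 0)) (lt (lenDiff .fst u v) (var .offset))))))).size ≤ _
  simp only [lt, lenDiff, LIAFormula.size, LIATerm.size, Finset.card_singleton, Int.natAbs_one,
    Nat.size_one, Int.natAbs_zero, Nat.size_zero]
  grw [size_parikhTagFormula_le hM hS ht hg, Finset.card_image_le, card_parikhVars_le hS ht hg,
    size_mismatchFormula_le hM hu hv hA hX hAX hS hC ht hg, size_lenSum_le hu, size_lenSum_le hv]
  have hM₂ : M ≤ M ^ 2 := Nat.le_self_pow two_ne_zero M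
  have hM₃ : M ^ 2 ≤ M ^ 3 := Nat.pow_le_pow_right hM (by omega)
  omega

theorem size_formula_le_of_card_le {K : ℕ} (hK : 1 ≤ K) (hu : u.length ≤ K)
    (hv : v.length ≤ K) (hA : Fintype.card A ≤ K) (hX : Fintype.card X ≤ K)
    (hQ : Fintype.card (Σ x, Q x) ≤ K) : (formula I aut u v).size ≤ 500 * (16 * K ^ 6) ^ 3 := by
  have hpow {i : ℕ} (hi : i ≤ 6) : K ^ i ≤ K ^ 6 := Nat.pow_le_pow_right hK hi
  have hK₁ : K ≤ K ^ 6 := Nat.le_self_pow (by omega) K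
  have hAX : Fintype.card (A × X) ≤ K ^ 2 := by
    rw [Fintype.card_prod, sq]
    gcongr
  have hC : (concatAut aut).trans.card ≤ 2 * K ^ 4 := by
    grw [card_concatAut_trans_le, hX, hA, hQ]
    linarith [Nat.pow_le_pow_right hK (show 2 ≤ 4 by omega)]
  have ht : (samplingAut aut).trans.card ≤ 16 * K ^ 6 := by
    grw [card_threeCopies_trans_le, hAX, hC]
    linarith [hpow (show 4 ≤ 6 by omega)]
  have hg : (samplingAut aut).tags.card ≤ 16 * K ^ 6 := by
    grw [card_threeCopies_tags_le, card_concatAut_tags_le, hAX, hX, hA]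
    linarith [hpow (show 2 ≤ 6 by omega)]
  refine size_formula_le_of_card_samplingAut_le I ?_ ?_ ?_ ?_ ?_ ?_ ?_ ?_ ht hg
  iterate 5 omega
  · linarith [hpow (show 2 ≤ 6 by omega)]
  · rw [Fintype.card_prod, Fintype.card_fin]
    omega
  · linarith [hpow (show 4 ≤ 6 by omega)]

theorem size_formula_le (hu : u ≠ []) (hv : v ≠ []) (hQ : ∀ x, Nonempty (Q x)) :
    (formula I aut u v).size ≤ 500 * (16 * ((Fintype.card A + 1) *
      (u.length * v.length * ∑ x, Fintype.card (Q x))) ^ 6) ^ 3 := by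
  rw [← Fintype.card_sigma]
  have hlenU := List.length_pos_iff.2 hu
  have hlenV := List.length_pos_iff.2 hv
  have hX : Fintype.card X ≤ Fintype.card (Σ x, Q x) :=
    Fintype.card_le_of_injective (fun x => ⟨x, (hQ x).some⟩) fun x y h => congrArg Sigma.fst h
  have hS : 0 < Fintype.card (Σ x, Q x) := (Fintype.card_pos_iff.2 ⟨u.head hu⟩).trans_le hX
  have hle {k : ℕ} (hk : k ∣ u.length * v.length * Fintype.card (Σ x, Q x)) :
      k ≤ (Fintype.card A + 1) * (u.length * v.length * Fintype.card (Σ x, Q x)) :=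
    Nat.le_of_dvd (by positivity) (hk.mul_left _)
  have hQle := hle (dvd_mul_left (Fintype.card (Σ x, Q x)) _)
  refine size_formula_le_of_card_le I (hle (one_dvd _)) (hle ((dvd_mul_right _ _).mul_right _))
    (hle ((dvd_mul_left _ _).mul_right _)) ?_ (hX.trans hQle) hQle
  exact (Nat.le_succ _).trans (Nat.le_mul_of_pos_right _ (by positivity))

end FormulaSize

end NotContains

theorem mainTheorem8 (A : Type*) [Fintype A] [Nonempty A] :
    ∃ p : Polynomial ℕ,
      ∀ (X : Type*) [Fintype X] [LinearOrder X] (I : Type*)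
        (Q : X → Type*) [∀ x, Fintype (Q x)] (aut : ∀ x, NFA A (Q x))
        (u v : List X), u ≠ [] → v ≠ [] →
        (∀ x, x ∈ u ∨ x ∈ v → (aut x).IsFlat) →
        (∀ ints : List (LIATerm I × LIATerm I),
          NotContainsSatisfiable aut ints u v ↔
            (LIAFormula.and (NotContains.intFormula ints)
              (NotContains.formula I aut u v)).Satisfiable) ∧
        ((∀ x, Nonempty (Q x)) →
          (NotContains.formula I aut u v).size ≤
            p.eval (u.length * v.length * ∑ x, Fintype.card (Q x))) := by
  refine ⟨.C 500 * (.C 16 * (.C (Fintype.card A + 1) * .X) ^ 6) ^ 3,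
    fun X _ _ I Q _ aut u v hu hv hflat =>
      ⟨fun ints => (NotContains.satisfiable_and_formula_iff hu hflat).symm, fun hQ => ?_⟩⟩
  simpa only [Polynomial.eval_mul, Polynomial.eval_pow, Polynomial.eval_C, Polynomial.eval_X]
    using NotContains.size_formula_le I hu hv hQ
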